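/- The grail network has nodes $i_1,i_2$ (input nodes), $o_1,o_2$ (output nodes) and $n_1,n_2,n_3,n_4$ (repeater nodes), and nine edges $i_1n_1,\ i_2n_1,\ i_2n_3,\ n_1n_2,\ n_2n_3,\ n_2o_1,\ n_3n_4,\ n_4o_1,\ n_4o_2$. Each edge is a quantum channel of capacity one qubit that can be used once, and classical communication between all nodes is free; equivalently, each edge $e$ provides one Bell pair $|\Phi^+\rangle=\frac1{\sqrt2}(|00\rangle+|11\rangle)$ whose two qubits are held by the two ends of $e$. Let $|\Phi\rangle=\bigotimes_e|\Phi^+\rangle_e$ be the resulting resource state. A two-qubit unitary $U$ is deterministically implementable over the network if there is an LOCC map $\Gamma$ (finitely many rounds of local quantum operations at the single nodes, ancillas allowed, with free classical communication of the outcomes) such that, for every pure state $|\psi\rangle$ of two qubits, the first held by $i_1$ and the second by $i_2$, $$\Gamma\bigl(|\psi\rangle\langle\psi|\otimes|\Phi\rangle\langle\Phi|\bigr)=U|\psi\rangle\langle\psi|U^\dagger ,$$ where the first output qubit is held by $o_1$ and the second by $o_2$. **Claim.** Every two-qubit unitary operation is deterministically implementable over the grail network. -/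

import Mathlib

noncomputable section

namespace NetworkCoding

open Matrix

/-- The tensor product over all nodes of the matrices `M v`: the matrix with respect to the product
bases of the two tensor product spaces. -/
def tensorOp {V : Type} [Fintype V] {A A' : V → Type} (M : ∀ v, Matrix (A' v) (A v) ℂ) :
    Matrix (∀ v, A' v) (∀ v, A v) ℂ :=
  Matrix.of fun x y => ∏ v, M v (x v) (y v)

/-- `IsLOCC B A Γ`: the map `Γ`, from operators on `⨂ v, ℂ^(A v)` to operators on `⨂ v, ℂ^(B v)`,
is realised by a finite protocol of local operations at the nodes `v` and unrestricted classical
communication. The types `A v` and `B v` label orthonormal bases of the spaces held by node `v`.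

In one round every node `v` performs a quantum instrument with Kraus operators `K v a`, `a : X v`,
and announces its outcome `a` to all nodes. The Hilbert space of a node may change in a round, so
that adding ancillas and discarding subsystems are included. The rest of the protocol may depend on
all outcomes; in the end the outcomes are forgotten (a sum over the outcomes). A node that does
nothing in a round has the single Kraus operator `1`. -/
inductive IsLOCC {V : Type} [Fintype V] [DecidableEq V]
    (B : V → Type) [∀ v, Fintype (B v)] [∀ v, DecidableEq (B v)] :
    (A : V → Type) → [∀ v, Fintype (A v)] → [∀ v, DecidableEq (A v)] →
      (Matrix (∀ v, A v) (∀ v, A v) ℂ → Matrix (∀ v, B v) (∀ v, B v) ℂ) → Prop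
  | done : IsLOCC B B (fun ρ => ρ)
  | round (A A' : V → Type) [∀ v, Fintype (A v)] [∀ v, DecidableEq (A v)]
      [∀ v, Fintype (A' v)] [∀ v, DecidableEq (A' v)]
      (X : V → Type) [∀ v, Fintype (X v)]
      (K : ∀ v, X v → Matrix (A' v) (A v) ℂ)
      (complete : ∀ v, ∑ a, (K v a)ᴴ * K v a = 1)
      (Γ : (∀ v, X v) → Matrix (∀ v, A' v) (∀ v, A' v) ℂ → Matrix (∀ v, B v) (∀ v, B v) ℂ)
      (rest : ∀ a, IsLOCC B A' (Γ a)) :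
      IsLOCC B A (fun ρ =>
        ∑ a : ∀ v, X v, Γ a (tensorOp (fun v => K v (a v)) * ρ * (tensorOp fun v => K v (a v))ᴴ))

/-- Basis labels of the Hilbert space of the qubits that are located at the node `v`, where the
qubit `q` is located at the node `loc q`. -/
abbrev LocalBasis {Q V : Type} (loc : Q → V) (v : V) : Type :=
  {q : Q // loc q = v} → Fin 2

/-- The bit string on all qubits that corresponds to a family of bit strings at the nodes. -/
def bits {Q V : Type} {loc : Q → V} (x : ∀ v, LocalBasis loc v) : Q → Fin 2 :=
  fun q => x (loc q) ⟨q, rfl⟩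

/-- The amplitudes of the Bell pair `(|00⟩ + |11⟩) / √2`. -/
def bell (a b : Fin 2) : ℂ :=
  if a = b then ((Real.sqrt 2 : ℝ) : ℂ)⁻¹ else 0

/-- The operator `|φ⟩⟨φ|`. -/
def proj {ι : Type} (φ : ι → ℂ) : Matrix ι ι ℂ :=
  Matrix.vecMulVec φ (star φ)

/-- A network with `k` input and `k` output nodes, node set `V` and edges `E`; every edge is a
channel of capacity one qubit between its two ends. -/
structure Network (V E : Type) (k : ℕ) where
  src : E → V
  dst : E → V
  input : Fin k → V
  output : Fin k → V
  input_injective : Function.Injective input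
  output_injective : Function.Injective output

namespace Network

variable {V E : Type} {k : ℕ}

/-- The location of the qubits present at the start: the input qubits, and for every edge the two
qubits of a Bell pair, one at each end of the edge. -/
def initialLoc (G : Network V E k) : Fin k ⊕ (E ⊕ E) → V :=
  Sum.elim G.input (Sum.elim G.src G.dst)

/-- The state `|ψ⟩ ⊗ |Φ⟩`, where `ψ` is a state of the input qubits and `Φ` is the resource state,
with one Bell pair for every edge. -/
def initialState [Fintype E] (G : Network V E k) (ψ : (Fin k → Fin 2) → ℂ) :
    (∀ v, LocalBasis G.initialLoc v) → ℂ :=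
  fun x => ψ (fun i => bits x (Sum.inl i)) *
    ∏ e, bell (bits x (Sum.inr (Sum.inl e))) (bits x (Sum.inr (Sum.inr e)))

/-- A `k`-qubit state `φ`, carried by the output qubits, the `i`-th one located at the `i`-th output
node. -/
def outputState (G : Network V E k) (φ : (Fin k → Fin 2) → ℂ) :
    (∀ v, LocalBasis G.output v) → ℂ :=
  fun y => φ (bits y)

/-- The `k`-qubit unitary `U` is deterministically implementable over `G`: some LOCC map, with local
operations at the nodes, takes `|ψ⟩⟨ψ| ⊗ |Φ⟩⟨Φ|` to `U|ψ⟩⟨ψ|U†` on the output qubits, for every pure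
state `ψ` of the input qubits. -/
def DeterministicallyImplementable [Fintype V] [DecidableEq V] [Fintype E]
    [DecidableEq E] (G : Network V E k) (U : Matrix.unitaryGroup (Fin k → Fin 2) ℂ) : Prop :=
  ∃ Γ, IsLOCC (LocalBasis G.output) (LocalBasis G.initialLoc) Γ ∧
    ∀ ψ : (Fin k → Fin 2) → ℂ, ∑ x, ‖ψ x‖ ^ 2 = 1 →
      Γ (proj (G.initialState ψ)) = proj (G.outputState ((U : Matrix _ _ ℂ) *ᵥ ψ))

end Network

/-- The nodes of the grail network. -/
inductive GrailNode
  | i₁ | i₂ | o₁ | o₂ | n₁ | n₂ | n₃ | n₄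
  deriving DecidableEq

instance : Fintype GrailNode where
  elems := {.i₁, .i₂, .o₁, .o₂, .n₁, .n₂, .n₃, .n₄}
  complete x := by cases x <;> decide

open GrailNode in
/-- The grail network. Its nine edges are `i₁n₁`, `i₂n₁`, `i₂n₃`, `n₁n₂`, `n₂n₃`, `n₂o₁`, `n₃n₄`,
`n₄o₁`, `n₄o₂`. -/
def grailNetwork : Network GrailNode (Fin 9) 2 where
  src := ![i₁, i₂, i₂, n₁, n₂, n₂, n₃, n₄, n₄]
  dst := ![n₁, n₁, n₃, n₂, n₃, o₁, n₄, o₁, o₂]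
  input := ![i₁, i₂]
  output := ![o₁, o₂]
  input_injective := by decide
  output_injective := by decide

end NetworkCoding

end

/-! Up to local unitaries and a global phase, a two-qubit unitary is a product of three commuting
factors, each locally equivalent to a diagonal gate exp(i t Z ⊗ Z) (Cartan decomposition). So it
suffices to run a circuit of local unitaries and three diagonal two-qubit gates. One Bell pair can
be spent in two ways: it teleports a qubit along its edge, or it performs a diagonal gate between
qubits at its two ends. Both copy a bit coherently across the edge (`QReaches.copy`) and later erase
one of the two copies by a measurement in the Hadamard basis (`QReaches.erase`). The grail has
exactly the right edges. The first qubit moves i₁, n₁, n₂, o₁ and the second i₂, n₃, n₄, o₂, which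
uses six edges. The remaining edges i₂n₁, n₂n₃, n₄o₁ join the two paths at three successive stages
and carry the three gates (`implementable_of_circuit`). For the decomposition
(`exists_cartan_decomposition`), U is written in the magic basis as O · diag · P with O, P real
orthogonal. Amplitude matrices identify ℝ⁴ with the quaternions, whose isometries are x ↦ p x q or x
↦ p x̄ q. The maps x ↦ p x q are local unitaries, and conjugation is diagonal in the magic basis, so
it joins the diagonal factor. `exists_quatMatrix_mul` splits that factor into three phase gates. -/

noncomputable section

namespace NetworkCoding

open Matrix

/-! ### LOCC protocols on families of pure states -/

section Reaches

variable {V : Type} [Fintype V] [DecidableEq V]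
  {B : V → Type} [∀ v, Fintype (B v)] [∀ v, DecidableEq (B v)]
  {A A' : V → Type} [∀ v, Fintype (A v)] [∀ v, DecidableEq (A v)]
  [∀ v, Fintype (A' v)] [∀ v, DecidableEq (A' v)]

/-- Homogeneity lets the probability of a measurement branch be pulled out of the rest of the
protocol. -/
theorem IsLOCC.map_smul {Γ : Matrix (∀ v, A v) (∀ v, A v) ℂ → Matrix (∀ v, B v) (∀ v, B v) ℂ}
    (h : IsLOCC B A Γ) (c : ℂ) (ρ : Matrix (∀ v, A v) (∀ v, A v) ℂ) : Γ (c • ρ) = c • Γ ρ := by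
  induction h with
  | done => rfl
  | round A A' X K complete Γ rest ih =>
    simp only [Finset.smul_sum, Matrix.mul_smul, Matrix.smul_mul, ih]

theorem proj_mulVec {ι κ : Type} [Fintype ι] [Fintype κ] (M : Matrix κ ι ℂ) (φ : ι → ℂ) :
    proj (M *ᵥ φ) = M * proj φ * Mᴴ := by
  rw [proj, proj, mul_vecMulVec, vecMulVec_mul, star_mulVec]

theorem proj_smul {ι : Type} (c : ℂ) (φ : ι → ℂ) : proj (c • φ) = (c * star c) • proj φ := by
  ext i j
  simp only [proj, vecMulVec_apply, Pi.smul_apply, Pi.star_apply, smul_eq_mul, Matrix.smul_apply,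
    star_mul']
  ring

/-- Some LOCC map takes the pure state `φ ψ` to the pure state `τ ψ`, for all `ψ`. -/
def Reaches {Ψ : Type} (φ : Ψ → (∀ v, A v) → ℂ) (τ : Ψ → (∀ v, B v) → ℂ) : Prop :=
  ∃ Γ, IsLOCC B A Γ ∧ ∀ ψ, Γ (proj (φ ψ)) = proj (τ ψ)

variable {Ψ : Type} {φ : Ψ → (∀ v, A v) → ℂ} {τ : Ψ → (∀ v, B v) → ℂ}

theorem Reaches.refl (τ : Ψ → (∀ v, B v) → ℂ) : Reaches τ τ := ⟨_, .done, fun _ => rfl⟩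

/-- One round of a protocol in which the outcome `a` leads to the state `φ' a`, with amplitude
`c a`. -/
theorem Reaches.round {X : V → Type} [∀ v, Fintype (X v)]
    (K : ∀ v, X v → Matrix (A' v) (A v) ℂ) (complete : ∀ v, ∑ a, (K v a)ᴴ * K v a = 1)
    (φ' : (∀ v, X v) → Ψ → (∀ v, A' v) → ℂ) (c : (∀ v, X v) → ℂ)
    (hc : ∑ a, c a * star (c a) = 1)
    (h : ∀ a ψ, tensorOp (fun v => K v (a v)) *ᵥ φ ψ = c a • φ' a ψ)
    (hr : ∀ a, Reaches (φ' a) τ) : Reaches φ τ := by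
  choose Γ hΓ hτ using hr
  refine ⟨_, IsLOCC.round A A' X K complete Γ hΓ, fun ψ => ?_⟩
  simp only [← proj_mulVec, h, proj_smul, (hΓ _).map_smul, hτ, ← Finset.sum_smul, hc, one_smul]

theorem sum_eq_sum_update {ι : Type} [Fintype ι] [DecidableEq ι] {C : ι → Type}
    [∀ v, Fintype (C v)] (x : ∀ v, C v) (v : ι) (F : (∀ v, C v) → ℂ)
    (hF : ∀ y, (∃ w, w ≠ v ∧ y w ≠ x w) → F y = 0) :
    ∑ y, F y = ∑ b, F (Function.update x v b) := by
  symm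
  refine Finset.sum_of_injOn (fun b => Function.update x v b)
    (Function.update_injective x v).injOn (by simp) (fun y _ hy => hF y ?_) (fun _ _ => rfl)
  by_contra! hne
  refine hy ⟨y v, by simp, ?_⟩
  ext w
  by_cases hw : w = v
  · subst hw; simp
  · simp [hw, hne w hw]

theorem tensorOp_update_one_mulVec (v : V) (M : Matrix (A v) (A v) ℂ) (f : (∀ v, A v) → ℂ)
    (x : ∀ v, A v) :
    (tensorOp (Function.update (fun _ => 1) v M) *ᵥ f) x =
      ∑ y, M (x v) y * f (Function.update x v y) := by
  rw [mulVec, dotProduct, sum_eq_sum_update x v]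
  · refine Finset.sum_congr rfl fun y _ => ?_
    congr 1
    rw [tensorOp, of_apply, Finset.prod_eq_single v]
    · simp
    · intro w _ hw
      simp [hw]
    · simp
  · rintro y ⟨w, hw, hne⟩
    rw [tensorOp, of_apply, Finset.prod_eq_zero (Finset.mem_univ w), zero_mul]
    simp [hw, one_apply_ne hne.symm]

theorem tensorOp_smul {V : Type} [Fintype V] {A A' : V → Type} (c : V → ℂ)
    (M : ∀ v, Matrix (A' v) (A v) ℂ) :
    tensorOp (fun v => c v • M v) = (∏ v, c v) • tensorOp M := by
  ext x y
  simp [tensorOp, Finset.prod_mul_distrib]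

/-- A round in which only the node `v` acts. -/
theorem Reaches.local_round (v : V) {S : Type} [Fintype S] [DecidableEq S] [Inhabited S]
    (M : S → Matrix (A v) (A v) ℂ) (complete : ∑ s, (M s)ᴴ * M s = 1)
    (φ' : S → Ψ → (∀ v, A v) → ℂ) (c : S → ℂ) (hc : ∑ s, c s * star (c s) = 1)
    (h : ∀ s ψ x, ∑ y, M s (x v) y * φ ψ (Function.update x v y) = c s * φ' s ψ x)
    (hr : ∀ s, Reaches (φ' s) τ) : Reaches φ τ := by
  -- All nodes share the outcome set `S`. An idle node has Kraus operator 1 at `default` and 0 at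
  -- every other outcome, so its completeness relation holds and the branches with a spurious
  -- outcome have amplitude 0.
  let k : V → S → ℂ := fun w s => if w = v then 1 else if s = default then 1 else 0
  refine Reaches.round (X := fun _ => S)
    (fun w s => k w s • Function.update (β := fun w => Matrix (A w) (A w) ℂ) (fun _ => 1) v (M s) w)
    ?_ (fun a => φ' (a v)) (fun a => ∏ w, (if w = v then c (a w) else k w (a w))) ?_ ?_
    (fun a => hr _)
  · intro w
    by_cases hw : w = v
    · subst hw
      simpa [k] using complete
    · rw [Finset.sum_eq_single default]
      · simp [k, hw]
      · intro s _ hs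
        simp [k, hw, hs]
      · simp
  · simp only [star_prod, ← Finset.prod_mul_distrib]
    rw [← Fintype.piFinset_univ, ← Finset.prod_univ_sum (fun _ => Finset.univ)
      (fun w s => (if w = v then c s else k w s) * star (if w = v then c s else k w s))]
    refine Finset.prod_eq_one fun w _ => ?_
    by_cases hw : w = v
    · simpa [hw] using hc
    · simp [hw, k]
  · intro a ψ
    rw [tensorOp_smul]
    have : (fun w => Function.update (β := fun w => Matrix (A w) (A w) ℂ) (fun _ => 1) v
        (M (a w)) w) = Function.update (fun _ => 1) v (M (a v)) := by
      ext w
      by_cases hw : w = v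
      · subst hw; simp
      · simp [hw]
    rw [this, smul_mulVec]
    ext x
    simp only [Pi.smul_apply, tensorOp_update_one_mulVec, h, smul_eq_mul, ← mul_assoc]
    congr 1
    rw [← Finset.mul_prod_erase _ _ (Finset.mem_univ v),
      ← Finset.mul_prod_erase _ (fun w => ite _ _ _) (Finset.mem_univ v)]
    simp only [k, if_true, one_mul, mul_comm _ (c (a v))]
    congr 1
    refine Finset.prod_congr rfl fun w hw => ?_
    simp [(Finset.mem_erase.mp hw).1]

end Reaches

/-! ### Operations on a single qubit, controlled by other qubits at its node -/

section Qubits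

variable {V : Type} [Fintype V] [DecidableEq V]
  {B : V → Type} [∀ v, Fintype (B v)] [∀ v, DecidableEq (B v)]
  {Q : Type} [Fintype Q] [DecidableEq Q] {loc : Q → V}
  {Ψ : Type} {φ : Ψ → (Q → Fin 2) → ℂ} {τ : Ψ → (∀ v, B v) → ℂ}

theorem bits_update {V Q : Type} [DecidableEq V] [DecidableEq Q] {loc : Q → V}
    (z : ∀ v, LocalBasis loc v) (q : Q) (b : Fin 2) :
    bits (Function.update z (loc q) (Function.update (z (loc q)) ⟨q, rfl⟩ b)) =
      Function.update (bits z) q b := by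
  funext r
  simp only [bits]
  by_cases hr : r = q
  · subst hr; simp
  · by_cases hl : loc r = loc q
    · have key : ∀ (v : V) (h : loc r = v) (y : LocalBasis loc v),
          (Function.update z v y) (loc r) ⟨r, rfl⟩ = y ⟨r, h⟩ := by
        rintro v rfl y; simp
      have key' : ∀ (v : V) (h : loc r = v), z (loc r) ⟨r, rfl⟩ = z v ⟨r, h⟩ := by
        rintro v rfl; rfl
      rw [key _ hl, Function.update_of_ne (by simpa using hr), Function.update_of_ne hr]
      exact (key' _ hl).symm
    · simp [hl, hr, bits]

/-- A variant of `Reaches` for states given by their amplitudes as functions of all bits. -/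
def QReaches (loc : Q → V) (φ : Ψ → (Q → Fin 2) → ℂ) (τ : Ψ → (∀ v, B v) → ℂ) : Prop :=
  Reaches (A := LocalBasis loc) (fun ψ z => φ ψ (bits z)) τ

/-- The node of the qubit `q` acts on this qubit, with Kraus operators that may depend on its other
bits. -/
theorem QReaches.round (q : Q) {S : Type} [Fintype S] [DecidableEq S] [Inhabited S]
    (C : S → LocalBasis loc (loc q) → Matrix (Fin 2) (Fin 2) ℂ)
    (hC : ∀ s a b, C s (Function.update a ⟨q, rfl⟩ b) = C s a)
    (complete : ∀ a, ∑ s, (C s a)ᴴ * C s a = 1)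
    (φ' : S → Ψ → (Q → Fin 2) → ℂ) (c : S → ℂ) (hc : ∑ s, c s * star (c s) = 1)
    (h : ∀ s ψ (z : ∀ v, LocalBasis loc v),
      ∑ b, C s (z (loc q)) (bits z q) b * φ ψ (Function.update (bits z) q b) =
        c s * φ' s ψ (bits z))
    (hr : ∀ s, QReaches loc (φ' s) τ) : QReaches loc φ τ := by
  let q' : {r // loc r = loc q} := ⟨q, rfl⟩
  -- The Kraus operator on the whole node is block diagonal: one 2 × 2 block for each setting of the
  -- other bits. By `hC` the block does not depend on the bit of `q` itself.
  let M : S → Matrix (LocalBasis loc (loc q)) (LocalBasis loc (loc q)) ℂ := fun s =>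
    of fun a b => if b = Function.update a q' (b q') then C s a (a q') (b q') else 0
  have hM : ∀ s a b, (∃ r, r ≠ q' ∧ b r ≠ a r) → M s a b = 0 := by
    rintro s a b ⟨r, hr, hne⟩
    refine if_neg fun hb => hne ?_
    rw [hb]; simp [hr]
  have hM' : ∀ s a b, (∃ r, r ≠ q' ∧ b r ≠ a r) → M s b a = 0 := by
    rintro s a b ⟨r, hr, hne⟩
    exact hM _ _ _ ⟨r, hr, hne.symm⟩
  have hMu : ∀ s a b, M s a (Function.update a q' b) = C s a (a q') b := by
    intro s a b
    simp [M]
  refine Reaches.local_round (loc q) M ?_ (fun s ψ z => φ' s ψ (bits z)) c hc ?_ hr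
  · ext a b
    have e : (∑ s, (M s)ᴴ * M s) a b =
        ∑ s, ∑ β, star (M s (Function.update a q' β) a) * M s (Function.update a q' β) b := by
      rw [Matrix.sum_apply]
      refine Finset.sum_congr rfl fun s _ => ?_
      rw [mul_apply, sum_eq_sum_update a q']
      · rfl
      · intro y hy
        rw [conjTranspose_apply, hM' _ _ _ hy, star_zero, zero_mul]
    rw [e]
    by_cases hab : ∃ r, r ≠ q' ∧ b r ≠ a r
    · rw [one_apply_ne (by rintro rfl; obtain ⟨r, -, hr⟩ := hab; exact hr rfl)]
      refine Finset.sum_eq_zero fun s _ => Finset.sum_eq_zero fun β _ => ?_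
      obtain ⟨r, hr, hne⟩ := hab
      rw [hM s (Function.update a q' β) b ⟨r, hr, by simpa [hr] using hne⟩, mul_zero]
    · push Not at hab
      have hb : b = Function.update a q' (b q') := by
        ext r
        by_cases hr : r = q'
        · subst hr; simp
        · simp [hr, hab r hr]
      have hu : ∀ s β γ, M s (Function.update a q' β) (Function.update a q' γ) = C s a β γ := by
        intro s β γ
        have := hMu s (Function.update a q' β) γ
        rwa [Function.update_idem, hC, Function.update_self] at this
      have hu' : ∀ s β, M s (Function.update a q' β) a = C s a β (a q') := by
        intro s β
        simpa using hu s β (a q')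
      rw [hb]
      simp only [hu, hu']
      have := congrFun (congrFun (complete a) (a q')) (b q')
      rw [Matrix.sum_apply] at this
      simp only [mul_apply, conjTranspose_apply] at this
      rw [this]
      simp only [one_apply]
      congr 1
      rw [eq_iff_iff]
      constructor
      · intro h; rw [← h]; simp
      · intro h; rw [h]; simp
  · intro s ψ z
    rw [← h, sum_eq_sum_update (z (loc q)) q']
    · refine Finset.sum_congr rfl fun b _ => ?_
      rw [hMu, bits_update]; rfl
    · intro y hy
      rw [hM _ _ _ hy, zero_mul]

theorem QReaches.controlled_round (q r : Q) (hqr : r ≠ q) (hloc : loc r = loc q)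
    {S : Type} [Fintype S] [DecidableEq S] [Inhabited S]
    (C : S → Fin 2 → Matrix (Fin 2) (Fin 2) ℂ)
    (complete : ∀ a, ∑ s, (C s a)ᴴ * C s a = 1)
    (φ' : S → Ψ → (Q → Fin 2) → ℂ) (c : S → ℂ) (hc : ∑ s, c s * star (c s) = 1)
    (h : ∀ s ψ z, ∑ b, C s (z r) (z q) b * φ ψ (Function.update z q b) = c s * φ' s ψ z)
    (hr : ∀ s, QReaches loc (φ' s) τ) : QReaches loc φ τ := by
  refine QReaches.round q (fun s a => C s (a ⟨r, hloc⟩)) ?_ (fun a => complete _) φ' c hc ?_ hr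
  · intro s a b
    simp [hqr]
  · intro s ψ z
    rw [← h]
    have key : ∀ (v : V) (h : loc r = v), z v ⟨r, h⟩ = bits z r := by
      rintro v rfl; rfl
    rw [key]

theorem QReaches.controlled_unitary (q r : Q) (hqr : r ≠ q) (hloc : loc r = loc q)
    (C : Fin 2 → Matrix (Fin 2) (Fin 2) ℂ) (hC : ∀ a, (C a)ᴴ * C a = 1)
    (h : QReaches loc (fun ψ z => ∑ b, C (z r) (z q) b * φ ψ (Function.update z q b)) τ) :
    QReaches loc φ τ :=
  QReaches.controlled_round q r hqr hloc (S := Unit) (fun _ => C) (by simpa using hC)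
    (fun _ ψ z => ∑ b, C (z r) (z q) b * φ ψ (Function.update z q b)) (fun _ => 1) (by simp)
    (by simp) (fun _ => h)

theorem QReaches.unitary (q : Q) (C : Matrix (Fin 2) (Fin 2) ℂ) (hC : Cᴴ * C = 1)
    (h : QReaches loc (fun ψ z => ∑ b, C (z q) b * φ ψ (Function.update z q b)) τ) :
    QReaches loc φ τ :=
  QReaches.round q (S := Unit) (fun _ _ => C) (by simp) (by simpa using hC)
    (fun _ ψ z => ∑ b, C (z q) b * φ ψ (Function.update z q b)) (fun _ => 1) (by simp)
    (by simp) (fun _ => h)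

end Qubits

/-! ### Teleportation and diagonal gates from one Bell pair -/

section Gadgets

variable {V : Type} [Fintype V] [DecidableEq V]
  {B : V → Type} [∀ v, Fintype (B v)] [∀ v, DecidableEq (B v)]
  {Q : Type} [Fintype Q] [DecidableEq Q] {loc : Q → V}
  {Ψ : Type} {φ : Ψ → (Q → Fin 2) → ℂ} {τ : Ψ → (∀ v, B v) → ℂ}

theorem QReaches.congr {φ' : Ψ → (Q → Fin 2) → ℂ} (h : QReaches loc φ' τ)
    (e : ∀ ψ z, φ ψ z = φ' ψ z) : QReaches loc φ τ := by
  have : φ = φ' := funext fun ψ => funext (e ψ)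
  rwa [this]

/-- The amplitude of each of the two outcomes of an unbiased measurement. -/
def invSqrtTwo : ℂ := ((Real.sqrt 2 : ℝ) : ℂ)⁻¹

theorem invSqrtTwo_mul_self : invSqrtTwo * invSqrtTwo = 1 / 2 := by
  rw [invSqrtTwo, ← mul_inv, ← Complex.ofReal_mul, Real.mul_self_sqrt (by norm_num)]
  norm_num

theorem star_invSqrtTwo : star invSqrtTwo = invSqrtTwo := by
  simp [invSqrtTwo]

theorem sum_invSqrtTwo_mul_star :
    ∑ _s : Fin 2, invSqrtTwo * star invSqrtTwo = 1 := by
  simp [star_invSqrtTwo, invSqrtTwo_mul_self]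

/-- The bit flip, applied `m` times. -/
def flip (m : Fin 2) : Matrix (Fin 2) (Fin 2) ℂ := of fun a b => if b = a + m then 1 else 0

theorem flip_conjTranspose_mul (m : Fin 2) : (flip m)ᴴ * flip m = 1 := by
  ext a b
  fin_cases m <;> fin_cases a <;> fin_cases b <;>
    simp [flip, mul_apply, Fin.sum_univ_two]

/-- The sign `(-1) ^ (s * b)`. -/
def sgn (s b : Fin 2) : ℂ := if s = 1 ∧ b = 1 then -1 else 1

theorem sgn_mul_sgn (s b : Fin 2) : sgn s b * sgn s b = 1 := by
  unfold sgn; split_ifs <;> norm_num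

theorem star_sgn (s b : Fin 2) : star (sgn s b) = sgn s b := by
  unfold sgn; split_ifs <;> simp

/-- With a Bell pair on the qubits `e` and `e'`, the bit of the qubit `x`, which is located at the
same node as `e`, is copied to the qubit `e'`. -/
theorem QReaches.copy {x e e' : Q} (hxe : x ≠ e) (hxe' : x ≠ e') (hee' : e ≠ e')
    (hloc : loc x = loc e) {g : Ψ → (Q → Fin 2) → ℂ}
    (hg : ∀ ψ z b, g ψ (Function.update z e b) = g ψ z)
    (hg' : ∀ ψ z b, g ψ (Function.update z e' b) = g ψ z)
    (h : QReaches loc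
      (fun ψ z => g ψ z * ((if z e = 0 then 1 else 0) * if z e' = z x then 1 else 0)) τ) :
    QReaches loc (fun ψ z => g ψ z * bell (z e) (z e')) τ := by
  -- Parity measurement of `x` and `e`: for outcome `m` the bit of `e` is `z x + m`, and `e` is
  -- reset to 0. Then `e'` carries `z x + m`, and its node undoes the shift with `flip m`.
  refine QReaches.controlled_round e x hxe hloc (S := Fin 2)
    (fun m c => of fun a b => if a = 0 ∧ b = c + m then 1 else 0) ?_
    (fun m ψ z => g ψ z * ((if z e = 0 then 1 else 0) * if z e' = z x + m then 1 else 0))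
    (fun _ => invSqrtTwo) sum_invSqrtTwo_mul_star ?_ ?_
  · intro c
    ext a b
    fin_cases c <;> fin_cases a <;> fin_cases b <;>
      simp [mul_apply, Fin.sum_univ_two]
  · intro m ψ z
    simp only [hg, Function.update_self, Function.update_of_ne hee'.symm, of_apply, bell]
    rw [Finset.sum_eq_single (z x + m) (fun b _ hb => by simp [hb]) (by simp)]
    by_cases h1 : z e = 0 <;> by_cases h2 : z e' = z x + m <;>
      simp [h1, h2, Ne.symm, invSqrtTwo, mul_comm]
  · intro m
    refine QReaches.unitary e' (flip m) (flip_conjTranspose_mul m) (h.congr fun ψ z => ?_)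
    simp only [hg', Function.update_self, Function.update_of_ne hee', Function.update_of_ne hxe',
      flip, of_apply]
    rw [Finset.sum_eq_single (z e' + m) (fun b _ hb => by simp [hb]) (by simp)]
    simp

/-- A qubit `x` whose bit equals the bit of the qubit `y` is reset to zero. -/
theorem QReaches.erase {x y : Q} (hxy : x ≠ y) {g : Ψ → (Q → Fin 2) → ℂ}
    (h : QReaches loc
      (fun ψ z => (if z x = 0 then 1 else 0) * g ψ (Function.update z x (z y))) τ) :
    QReaches loc (fun ψ z => g ψ z * if z x = z y then 1 else 0) τ := by
  -- Measuring `x` in the Hadamard basis reveals nothing about the common bit and leaves only the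
  -- sign `sgn s (z y)`. Since `y` still holds that bit, a diagonal sign gate on `y` removes it,
  -- wherever `y` is located.
  refine QReaches.round x (S := Fin 2)
    (fun s _ => of fun a b => if a = 0 then invSqrtTwo * sgn s b else 0) (by simp) ?_
    (fun s ψ z => sgn s (z y) * ((if z x = 0 then 1 else 0) * g ψ (Function.update z x (z y))))
    (fun _ => invSqrtTwo) sum_invSqrtTwo_mul_star ?_ ?_
  · have h2 : (starRingEnd ℂ) invSqrtTwo * invSqrtTwo = 1 / 2 := by
      rw [← invSqrtTwo_mul_self]
      congr 1
      exact star_invSqrtTwo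
    intro _
    ext a b
    fin_cases a <;> fin_cases b <;>
      simp [mul_apply, Fin.sum_univ_two, sgn, h2] <;> norm_num
  · intro s ψ z
    rw [Finset.sum_eq_single (bits z y)]
    · simp [hxy.symm]
      ring_nf
    · intro b _ hb
      simp [hxy.symm, hb]
    · simp
  · intro s
    refine QReaches.unitary y (diagonal (sgn s)) ?_ (h.congr fun ψ z => ?_)
    · ext a b
      by_cases hab : a = b
      · subst hab
        simp only [diagonal_conjTranspose, diagonal_mul_diagonal, diagonal_apply_eq, Pi.star_apply,
          star_sgn, sgn_mul_sgn, one_apply_eq]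
      · simp [hab, diagonal_apply_ne]
    · rw [Finset.sum_eq_single (z y)]
      · simp [← mul_assoc, sgn_mul_sgn]
      · intro b _ hb
        simp [diagonal_apply_ne _ hb.symm]
      · simp

/-- Teleportation of the qubit `x` by means of a Bell pair. -/
theorem QReaches.teleport {x e e' : Q} (hxe : x ≠ e) (hxe' : x ≠ e') (hee' : e ≠ e')
    (hloc : loc x = loc e) {g : Ψ → (Q → Fin 2) → ℂ}
    (hg : ∀ ψ z b, g ψ (Function.update z e b) = g ψ z)
    (hg' : ∀ ψ z b, g ψ (Function.update z e' b) = g ψ z)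
    (h : QReaches loc (fun ψ z => (if z x = 0 then 1 else 0) * ((if z e = 0 then 1 else 0) *
      g ψ (Function.update z x (z e')))) τ) :
    QReaches loc (fun ψ z => g ψ z * bell (z e) (z e')) τ := by
  refine QReaches.copy hxe hxe' hee' hloc hg hg' ?_
  -- After the copy, the original is erased and the copy survives.
  refine (QReaches.erase (x := x) (y := e') hxe'
    (g := fun ψ z => g ψ z * if z e = 0 then 1 else 0) ?_).congr ?_
  · refine h.congr fun ψ z => ?_
    simp only [Function.update_of_ne hxe.symm]
    ring
  · intro ψ z
    simp only [eq_comm (a := z x)]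
    ring

/-- A diagonal gate between the qubits `x` and `y` by means of a Bell pair. -/
theorem QReaches.diagonal_gate {x y e e' : Q} (hxe : x ≠ e) (hxe' : x ≠ e') (hee' : e ≠ e')
    (hye' : y ≠ e') (hloc : loc x = loc e) (hloc' : loc y = loc e')
    {g : Ψ → (Q → Fin 2) → ℂ}
    (hg : ∀ ψ z b, g ψ (Function.update z e b) = g ψ z)
    (hg' : ∀ ψ z b, g ψ (Function.update z e' b) = g ψ z)
    (d : Fin 2 → Fin 2 → ℂ) (hd : ∀ a b, star (d a b) * d a b = 1)
    (h : QReaches loc (fun ψ z => (if z e' = 0 then 1 else 0) * ((if z e = 0 then 1 else 0) *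
      (d (z x) (z y) * g ψ z))) τ) :
    QReaches loc (fun ψ z => g ψ z * bell (z e) (z e')) τ := by
  refine QReaches.copy hxe hxe' hee' hloc hg hg' ?_
  refine QReaches.controlled_unitary e' y hye' hloc' (fun b => diagonal fun a => d a b) ?_ ?_
  · intro b
    rw [diagonal_conjTranspose, diagonal_mul_diagonal, ← diagonal_one]
    congr 1
    ext a
    exact hd a b
  -- Here the copy is erased and the original survives. This is possible because a diagonal gate
  -- leaves the copied bit equal to the original.
  refine (QReaches.erase (x := e') (y := x) hxe'.symm
    (g := fun ψ z => d (z e') (z y) * (g ψ z * if z e = 0 then 1 else 0)) ?_).congr ?_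
  · refine h.congr fun ψ z => ?_
    simp only [Function.update_of_ne hee', Function.update_self, Function.update_of_ne hye', hg']
    ring
  · intro ψ z
    rw [Finset.sum_eq_single (z e')]
    · simp
    · intro b _ hb
      simp [diagonal_apply_ne _ hb.symm]
    · simp

end Gadgets

/-! ### Two data qubits together with the unused Bell pairs -/

section PairState

variable {V : Type} [Fintype V] [DecidableEq V]
  {B : V → Type} [∀ v, Fintype (B v)] [∀ v, DecidableEq (B v)]
  {Q E : Type} [Fintype Q] [DecidableEq Q] {loc : Q → V}
  {Ψ : Type} {τ : Ψ → (∀ v, B v) → ℂ} {s d : E → Q}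

/-- The state with the two-qubit state `χ ψ` on the qubits `p` and `q`, Bell pairs on the qubits
`s e` and `d e` for all `e` in `T`, and zeros on the qubits in `R`. -/
def pairState (s d : E → Q) (p q : Q) (T : List E) (R : List Q) (χ : Ψ → Matrix (Fin 2) (Fin 2) ℂ) :
    Ψ → (Q → Fin 2) → ℂ :=
  fun ψ z => χ ψ (z p) (z q) * (T.map fun e => bell (z (s e)) (z (d e))).prod *
    (R.map fun r => if z r = 0 then 1 else 0).prod

/-- The qubits on which `pairState` is supported. -/
def support (s d : E → Q) (p q : Q) (T : List E) (R : List Q) : List Q :=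
  p :: q :: (T.flatMap (fun e => [s e, d e]) ++ R)

theorem pairState_update {Q E Ψ : Type} [DecidableEq Q] {s d : E → Q} {p q : Q} {T : List E}
    {R : List Q} {χ : Ψ → Matrix (Fin 2) (Fin 2) ℂ} {x : Q}
    (hx : x ∉ support s d p q T R) (ψ : Ψ) (z : Q → Fin 2) (b : Fin 2) :
    pairState s d p q T R χ ψ (Function.update z x b) = pairState s d p q T R χ ψ z := by
  simp only [support, List.mem_cons, List.mem_append, List.mem_flatMap, not_or, not_exists,
    not_and, List.not_mem_nil, or_false] at hx
  obtain ⟨hp, hq, hT, hR⟩ := hx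
  unfold pairState
  rw [Function.update_of_ne (Ne.symm hp), Function.update_of_ne (Ne.symm hq)]
  congr 2
  · congr 1
    refine List.map_congr_left fun e he => ?_
    obtain ⟨h1, h2⟩ := hT e he
    rw [Function.update_of_ne (Ne.symm h1), Function.update_of_ne (Ne.symm h2)]
  · refine List.map_congr_left fun r hr => ?_
    rw [Function.update_of_ne]
    rintro rfl
    exact hR hr

theorem pairState_cons {Q E Ψ : Type} {s d : E → Q} (p q : Q) (e : E) (T : List E) (R : List Q)
    (χ : Ψ → Matrix (Fin 2) (Fin 2) ℂ)
    (ψ : Ψ) (z : Q → Fin 2) : pairState s d p q (e :: T) R χ ψ z =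
      pairState s d p q T R χ ψ z * bell (z (s e)) (z (d e)) := by
  simp only [pairState, List.map_cons, List.prod_cons]
  ring

/-- Exchanging the data qubits transposes the amplitude matrix, so each statement about the left
qubit yields one about the right qubit. -/
theorem pairState_swap {Q E Ψ : Type} {s d : E → Q} (p q : Q) (T : List E) (R : List Q)
    (χ : Ψ → Matrix (Fin 2) (Fin 2) ℂ) :
    pairState s d q p T R (fun ψ => (χ ψ)ᵀ) = pairState s d p q T R χ := rfl

theorem nodup_support {Q E : Type} {s d : E → Q} {p q : Q} {e : E} {T : List E} {R : List Q}
    (hn : (support s d p q (e :: T) R).Nodup) :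
    s e ∉ support s d p q T R ∧ d e ∉ support s d p q T R ∧ p ≠ s e ∧ p ≠ d e ∧ q ≠ d e ∧
      s e ≠ d e ∧ p ≠ q ∧ (∀ e' ∈ T, p ≠ s e' ∧ p ≠ d e') ∧ p ∉ R := by
  simp only [support, List.flatMap_cons, List.cons_append, List.nil_append, List.nodup_cons,
    List.mem_cons, List.mem_append, List.mem_flatMap, not_or, List.not_mem_nil,
    or_false, not_exists, not_and] at hn ⊢
  obtain ⟨⟨h1, h2, h3, h4, h5⟩, ⟨h6, h7, h8, h9⟩, ⟨h10, h11⟩, ⟨h12, -⟩⟩ := hn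
  exact ⟨⟨Ne.symm h2, Ne.symm h6, h11⟩, ⟨Ne.symm h3, Ne.symm h7, h12⟩, h2, h3, h7, h10, h1, h4, h5⟩

theorem QReaches.teleport_left {p q : Q} {e : E} {T : List E} {R : List Q}
    {χ : Ψ → Matrix (Fin 2) (Fin 2) ℂ} (hn : (support s d p q (e :: T) R).Nodup)
    (hloc : loc p = loc (s e))
    (h : QReaches loc (pairState s d (d e) q T (p :: s e :: R) χ) τ) :
    QReaches loc (pairState s d p q (e :: T) R χ) τ := by
  obtain ⟨hs, hd, hps, hpd, hqd, hsd, hpq, hpT, hpR⟩ := nodup_support hn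
  refine (QReaches.teleport (g := pairState s d p q T R χ) hps hpd hsd hloc (pairState_update hs)
    (pairState_update hd) (h.congr fun ψ z => ?_)).congr (pairState_cons p q e T R χ)
  have hT : (T.map fun e' => bell (Function.update z p (z (d e)) (s e'))
      (Function.update z p (z (d e)) (d e'))) = T.map fun e' => bell (z (s e')) (z (d e')) := by
    refine List.map_congr_left fun e' he' => ?_
    obtain ⟨h1, h2⟩ := hpT e' he'
    rw [Function.update_of_ne h1.symm, Function.update_of_ne h2.symm]
  have hR : (R.map fun r => if Function.update z p (z (d e)) r = 0 then (1 : ℂ) else 0) =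
      R.map fun r => if z r = 0 then 1 else 0 := by
    refine List.map_congr_left fun r hr => ?_
    rw [Function.update_of_ne]
    rintro rfl
    exact hpR hr
  simp only [pairState, hT, hR, Function.update_self, Function.update_of_ne hpq.symm,
    List.map_cons, List.prod_cons]
  ring

theorem QReaches.gate_left {p q : Q} {e : E} {T : List E} {R : List Q}
    {χ : Ψ → Matrix (Fin 2) (Fin 2) ℂ} (hn : (support s d p q (e :: T) R).Nodup)
    (hloc : loc p = loc (s e)) (hloc' : loc q = loc (d e))
    (D : Matrix (Fin 2) (Fin 2) ℂ) (hD : ∀ a b, star (D a b) * D a b = 1)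
    (h : QReaches loc
      (pairState s d p q T (s e :: d e :: R) fun ψ => D ⊙ χ ψ) τ) :
    QReaches loc (pairState s d p q (e :: T) R χ) τ := by
  obtain ⟨hs, hd, hps, hpd, hqd, hsd, -⟩ := nodup_support hn
  refine (QReaches.diagonal_gate (g := pairState s d p q T R χ) hps hpd hsd hqd hloc hloc'
    (pairState_update hs) (pairState_update hd) D hD (h.congr fun ψ z => ?_)).congr
    (pairState_cons p q e T R χ)
  simp only [pairState, List.map_cons, List.prod_cons, hadamard_apply]
  ring

theorem QReaches.unitary_left {p q : Q} {T : List E} {R : List Q}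
    {χ : Ψ → Matrix (Fin 2) (Fin 2) ℂ} (hn : (support s d p q T R).Nodup)
    (C : Matrix (Fin 2) (Fin 2) ℂ) (hC : Cᴴ * C = 1)
    (h : QReaches loc (pairState s d p q T R fun ψ => C * χ ψ) τ) :
    QReaches loc (pairState s d p q T R χ) τ := by
  refine QReaches.unitary p C hC (h.congr fun ψ z => ?_)
  have hp : p ∉ q :: (T.flatMap (fun e => [s e, d e]) ++ R) := (List.nodup_cons.mp hn).1
  simp only [List.mem_cons, List.mem_append, List.mem_flatMap, not_or, not_exists,
    not_and, List.not_mem_nil, or_false] at hp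
  obtain ⟨hpq, hpT, hpR⟩ := hp
  have hT : ∀ b, (T.map fun e' => bell (Function.update z p b (s e'))
      (Function.update z p b (d e'))) = T.map fun e' => bell (z (s e')) (z (d e')) := by
    intro b
    refine List.map_congr_left fun e' he' => ?_
    obtain ⟨h1, h2⟩ := hpT e' he'
    rw [Function.update_of_ne (Ne.symm h1), Function.update_of_ne (Ne.symm h2)]
  have hR : ∀ b, (R.map fun r => if Function.update z p b r = 0 then (1 : ℂ) else 0) =
      R.map fun r => if z r = 0 then 1 else 0 := by
    intro b
    refine List.map_congr_left fun r hr => ?_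
    rw [Function.update_of_ne]
    rintro rfl
    exact hpR hr
  simp only [pairState, hT, hR, Function.update_self, Function.update_of_ne (Ne.symm hpq),
    Finset.sum_mul, mul_assoc, mul_apply]

end PairState

/-! ### Discarding subsystems in a known state -/

section Discard

variable {V : Type} [Fintype V] [DecidableEq V]
  {A B : V → Type} [∀ v, Fintype (A v)] [∀ v, DecidableEq (A v)]
  [∀ v, Fintype (B v)] [∀ v, DecidableEq (B v)]
  {Ψ : Type}

/-- Subsystems in a known basis state can be discarded. -/
theorem Reaches.discard {X : V → Type} [∀ v, Fintype (X v)] [∀ v, DecidableEq (X v)]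
    (f : ∀ v, A v ≃ B v × X v) (x₀ : ∀ v, X v) (τ : Ψ → (∀ v, B v) → ℂ) :
    Reaches (fun ψ (z : ∀ v, A v) => τ ψ (fun v => (f v (z v)).1) *
      if (fun v => (f v (z v)).2) = x₀ then 1 else 0) τ := by
  -- Each node measures its discarded part in the standard basis. Only the outcome `x₀` has nonzero
  -- amplitude, so the state assigned to the other branches is arbitrary and `τ` serves for all.
  refine Reaches.round (fun v a => of fun y z => if f v z = (y, a) then 1 else 0) ?_
    (fun _ => τ) (fun a => if a = x₀ then 1 else 0) ?_ ?_ fun _ => Reaches.refl τ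
  · intro v
    ext z z'
    simp only [Matrix.sum_apply, mul_apply, conjTranspose_apply, of_apply]
    rw [Finset.sum_comm, ← Fintype.sum_prod_type'
      (f := fun y a => star (if f v z = (y, a) then (1 : ℂ) else 0) *
        if f v z' = (y, a) then 1 else 0)]
    simp [one_apply, apply_ite, eq_comm]
  · simp
  · intro a ψ
    funext y
    rw [mulVec, dotProduct, Finset.sum_eq_single fun v => (f v).symm (y v, a v)]
    · simp [tensorOp, mul_comm, eq_comm]
    · intro z _ hz
      obtain ⟨v, hv⟩ := Function.ne_iff.mp hz
      rw [tensorOp, of_apply, Finset.prod_eq_zero (Finset.mem_univ v), zero_mul]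
      rw [of_apply, if_neg]
      intro h
      exact hv (by rw [← h]; simp)
    · simp

theorem prod_map_ite {Q : Type} (R : List Q) (P : Q → Prop) [DecidablePred P]
    [Decidable (∀ r ∈ R, P r)] :
    (R.map fun r => if P r then (1 : ℂ) else 0).prod = if ∀ r ∈ R, P r then 1 else 0 := by
  split_ifs with h
  · refine List.prod_eq_one fun x hx => ?_
    obtain ⟨r, hr, rfl⟩ := List.mem_map.mp hx
    simp [h r hr]
  · push Not at h
    obtain ⟨r, hr, hP⟩ := h
    exact List.prod_eq_zero (List.mem_map.mpr ⟨r, hr, by simp [hP]⟩)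

/-- Qubits in the state zero can be discarded. -/
theorem QReaches.discard {Q Q' : Type} [Fintype Q] [DecidableEq Q] [Fintype Q'] [DecidableEq Q']
    {loc : Q → V} {loc' : Q' → V} (i : Q' → Q) (hi : Function.Injective i)
    (hloc : ∀ q, loc (i q) = loc' q) (R : List Q) (hR : ∀ r, r ∈ R ↔ r ∉ Set.range i)
    (τ : Ψ → (Q' → Fin 2) → ℂ) :
    QReaches loc (fun ψ z => τ ψ (fun q => z (i q)) *
        (R.map fun r => if z r = 0 then 1 else 0).prod)
      (fun ψ (y : ∀ v, LocalBasis loc' v) => τ ψ (bits y)) := by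
  classical
  let X : V → Type := fun v => {r : Q // loc r = v ∧ r ∉ Set.range i} → Fin 2
  let f : ∀ v, LocalBasis loc v → LocalBasis loc' v × X v := fun v z =>
    (fun q => z ⟨i q, (hloc q).trans q.2⟩, fun r => z ⟨r, r.2.1⟩)
  have hf : ∀ v, Function.Bijective (f v) := by
    intro v
    constructor
    · intro z z' h
      funext ⟨r, hr⟩
      by_cases hri : r ∈ Set.range i
      · obtain ⟨q, rfl⟩ := hri
        exact congrFun (congrArg Prod.fst h) ⟨q, (hloc q).symm.trans hr⟩
      · exact congrFun (congrArg Prod.snd h) ⟨r, hr, hri⟩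
    · rintro ⟨y, a⟩
      refine ⟨fun r => if h : ∃ q : {q // loc' q = v}, i q = r then y h.choose
        else if h' : r.1 ∉ Set.range i then a ⟨r, r.2, h'⟩ else 0, Prod.ext ?_ ?_⟩
      · funext q
        have h : ∃ q' : {q // loc' q = v}, i q' = i q := ⟨q, rfl⟩
        have : h.choose = q := Subtype.ext (hi h.choose_spec)
        simp only [f]
        rw [dif_pos h, this]
      · funext r
        have h : ¬ ∃ q' : {q // loc' q = v}, i q' = r := fun ⟨q', h⟩ => r.2.2 ⟨q', h⟩
        simp only [f]
        rw [dif_neg h, dif_pos r.2.2]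
  have := Reaches.discard (fun v => Equiv.ofBijective (f v) (hf v)) (fun _ => 0)
    (fun ψ (y : ∀ v, LocalBasis loc' v) => τ ψ (bits y))
  unfold QReaches
  convert this using 4 with ψ z
  · congr 1
    funext q
    simp only [bits, Equiv.ofBijective_apply, f]
    have key : ∀ (v : V) (h : loc (i q) = v), bits z (i q) = z v ⟨i q, h⟩ := by
      rintro v rfl; rfl
    exact key _ _
  · refine (prod_map_ite R fun r => bits z r = 0).trans (if_congr ?_ rfl rfl)
    simp only [Equiv.ofBijective_apply, f, funext_iff, hR]
    constructor
    · rintro h v ⟨r, rfl, hr⟩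
      exact h r hr
    · intro h r hr
      exact h (loc r) ⟨r, rfl, hr⟩

end Discard

/-! ### Operations on the right qubit -/

section PairStateRight

variable {V : Type} [Fintype V] [DecidableEq V]
  {B : V → Type} [∀ v, Fintype (B v)] [∀ v, DecidableEq (B v)]
  {Q E : Type} [Fintype Q] [DecidableEq Q] {loc : Q → V}
  {Ψ : Type} {τ : Ψ → (∀ v, B v) → ℂ} {s d : E → Q}
  {p q : Q} {e : E} {T : List E} {R : List Q}

theorem QReaches.teleport_right {χ : Ψ → Matrix (Fin 2) (Fin 2) ℂ}
    (hn : (support s d q p (e :: T) R).Nodup) (hloc : loc q = loc (s e))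
    (h : QReaches loc (pairState s d p (d e) T (q :: s e :: R) χ) τ) :
    QReaches loc (pairState s d p q (e :: T) R χ) τ := by
  rw [← pairState_swap] at h ⊢
  exact QReaches.teleport_left hn hloc h

theorem QReaches.gate_right {χ : Ψ → Matrix (Fin 2) (Fin 2) ℂ}
    (hn : (support s d q p (e :: T) R).Nodup)
    (hloc : loc q = loc (s e)) (hloc' : loc p = loc (d e))
    (D : Matrix (Fin 2) (Fin 2) ℂ) (hD : ∀ a b, star (D a b) * D a b = 1)
    (h : QReaches loc
      (pairState s d p q T (s e :: d e :: R) fun ψ => D ⊙ χ ψ) τ) :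
    QReaches loc (pairState s d p q (e :: T) R χ) τ := by
  rw [← pairState_swap] at h ⊢
  exact QReaches.gate_left hn hloc hloc' Dᵀ (fun a b => hD b a) h

/-- Multiplying the amplitude matrix by `C` on the right is the gate `Cᵀ` on the second qubit, and
`Cᵀ` is again unitary. -/
theorem QReaches.unitary_pair {χ : Ψ → Matrix (Fin 2) (Fin 2) ℂ}
    (hn : (support s d p q T R).Nodup) (hn' : (support s d q p T R).Nodup)
    (A C : unitaryGroup (Fin 2) ℂ)
    (h : QReaches loc (pairState s d p q T R fun ψ =>
      (A : Matrix (Fin 2) (Fin 2) ℂ) * χ ψ * (C : Matrix (Fin 2) (Fin 2) ℂ)) τ) :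
    QReaches loc (pairState s d p q T R χ) τ := by
  refine QReaches.unitary_left hn A (mem_unitaryGroup_iff'.mp A.2) ?_
  rw [← pairState_swap]
  refine QReaches.unitary_left hn' (C : Matrix _ _ ℂ)ᵀ ?_ ?_
  · have := mem_unitaryGroup_iff.mp C.2
    rw [star_eq_conjTranspose] at this
    rw [← transpose_one, ← this, transpose_mul]
    rfl
  rw [← pairState_swap]
  simpa only [transpose_mul, transpose_transpose] using h

end PairStateRight

/-! ### Running the circuit on the grail network -/

/-- The amplitudes of a two-qubit state as a matrix. -/
def ampMatrix (ψ : (Fin 2 → Fin 2) → ℂ) : Matrix (Fin 2) (Fin 2) ℂ := of fun a b => ψ ![a, b]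

theorem QReaches.discard_pairState {V Q E Ψ : Type} [Fintype V] [DecidableEq V] [Fintype Q]
    [DecidableEq Q] {loc : Q → V} {loc' : Fin 2 → V} {s d : E → Q} {p q : Q} {R : List Q}
    (hn : (support s d p q [] R).Nodup) (hR : (support s d p q [] R).toFinset = Finset.univ)
    (hloc : ∀ i, loc (![p, q] i) = loc' i) (φ : Ψ → (Fin 2 → Fin 2) → ℂ) :
    QReaches loc (pairState s d p q [] R fun ψ => ampMatrix (φ ψ))
      (fun ψ (y : ∀ v, LocalBasis loc' v) => φ ψ (bits y)) := by
  simp only [Finset.eq_univ_iff_forall, List.mem_toFinset, support, List.flatMap_nil,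
      List.nil_append, List.nodup_cons, List.mem_cons,
    not_or] at hn hR
  obtain ⟨⟨hpq, hp⟩, hq, -⟩ := hn
  refine (QReaches.discard ![p, q] ?_ hloc R ?_ φ).congr fun ψ z => ?_
  · intro i j
    fin_cases i <;> fin_cases j <;> simp [hpq, Ne.symm hpq]
  · intro r
    suffices h : r ∈ R ↔ ¬(p = r ∨ q = r) by
      simpa only [Set.mem_range, Fin.exists_fin_two, cons_val_zero, cons_val_one] using h
    constructor
    · rintro hr (rfl | rfl)
      exacts [hp hr, hq hr]
    · rintro h
      rcases hR r with rfl | rfl | hr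
      exacts [absurd (Or.inl rfl) h, absurd (Or.inr rfl) h, hr]
  · rw [pairState, List.map_nil, List.prod_nil, mul_one, ampMatrix, of_apply]
    congr 2
    funext i
    fin_cases i <;> rfl

/-- The gates `D 0`, `D 1`, `D 2` are performed over i₂n₁, n₂n₃ and n₄o₁, at the moments when the
data qubits sit at the ends of these edges. The Hadamard product `⊙` is the action of a diagonal
two-qubit gate on amplitude matrices. -/
theorem implementable_of_circuit (U : unitaryGroup (Fin 2 → Fin 2) ℂ)
    (A C : Fin 4 → unitaryGroup (Fin 2) ℂ) (D : Fin 3 → Matrix (Fin 2) (Fin 2) ℂ)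
    (hD : ∀ j a b, star (D j a b) * D j a b = 1)
    (hU : ∀ ψ, ampMatrix ((U : Matrix _ _ ℂ) *ᵥ ψ) =
      A 3 * (D 2 ⊙ (A 2 * (D 1 ⊙ (A 1 * (D 0 ⊙ (A 0 * ampMatrix ψ * C 0)) * C 1)) * C 2)) * C 3) :
    grailNetwork.DeterministicallyImplementable U := by
  let s : Fin 9 → Fin 2 ⊕ (Fin 9 ⊕ Fin 9) := fun e => .inr (.inl e)
  let d : Fin 9 → Fin 2 ⊕ (Fin 9 ⊕ Fin 9) := fun e => .inr (.inr e)
  suffices h : QReaches grailNetwork.initialLoc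
      -- The edges are listed in the order in which their Bell pairs are consumed.
      (pairState s d (.inl 0) (.inl 1) [0, 1, 3, 2, 4, 5, 6, 7, 8] [] ampMatrix)
      (fun ψ => grailNetwork.outputState ((U : Matrix _ _ ℂ) *ᵥ ψ)) by
    obtain ⟨Γ, hΓ, hτ⟩ := h
    refine ⟨Γ, hΓ, fun ψ _ => ?_⟩
    rw [← hτ]
    refine congrArg (fun φ => Γ (proj φ)) (funext fun x => ?_)
    have hψ : ampMatrix ψ (bits x (.inl 0)) (bits x (.inl 1)) =
        ψ fun i => bits x (Sum.inl i) := by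
      rw [ampMatrix, of_apply]
      congr 1
      funext i
      fin_cases i <;> rfl
    have hT := List.prod_toFinset
      (fun e => bell (bits x (.inr (.inl e))) (bits x (.inr (.inr e))))
      (show [(0 : Fin 9), 1, 3, 2, 4, 5, 6, 7, 8].Nodup by decide)
    rw [show [(0 : Fin 9), 1, 3, 2, 4, 5, 6, 7, 8].toFinset = Finset.univ by decide] at hT
    beta_reduce
    rw [Network.initialState, hT, pairState, hψ, List.map_nil, List.prod_nil, mul_one]
  refine .unitary_pair (by decide) (by decide) (A 0) (C 0) ?_
  refine .teleport_left (by decide) rfl ?_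
  refine .gate_right (by decide) rfl rfl (D 0) (hD 0) ?_
  refine .unitary_pair (by decide) (by decide) (A 1) (C 1) ?_
  refine .teleport_left (by decide) rfl ?_
  refine .teleport_right (by decide) rfl ?_
  refine .gate_left (by decide) rfl rfl (D 1) (hD 1) ?_
  refine .unitary_pair (by decide) (by decide) (A 2) (C 2) ?_
  refine .teleport_left (by decide) rfl ?_
  refine .teleport_right (by decide) rfl ?_
  refine .gate_right (by decide) rfl rfl (D 2) (hD 2) ?_
  refine .unitary_pair (by decide) (by decide) (A 3) (C 3) ?_
  refine .teleport_right (by decide) rfl ?_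
  simp only [← hU]
  exact .discard_pairState (by decide) (by decide) (by decide) _

/-! ### Unitary matrices as orthogonal times diagonal times orthogonal -/

section JointDiagonalization

open Module.End

theorem exists_orthogonal_joint_diagonalization {n : ℕ} {A B : Matrix (Fin n) (Fin n) ℝ}
    (hA : A.IsHermitian) (hB : B.IsHermitian) (hAB : Commute A B) :
    ∃ P ∈ orthogonalGroup (Fin n) ℝ, ∃ α β : Fin n → ℝ,
      A * P = P * diagonal α ∧ B * P = P * diagonal β := by
  classical
  let a : EuclideanSpace ℝ (Fin n) →ₗ[ℝ] EuclideanSpace ℝ (Fin n) := toEuclideanLin A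
  let b : EuclideanSpace ℝ (Fin n) →ₗ[ℝ] EuclideanSpace ℝ (Fin n) := toEuclideanLin B
  have ha : a.IsSymmetric := isSymmetric_toEuclideanLin_iff.mpr hA
  have hb : b.IsSymmetric := isSymmetric_toEuclideanLin_iff.mpr hB
  have hab : Commute a b := by
    have h : ∀ C D : Matrix (Fin n) (Fin n) ℝ,
        toEuclideanLin C * toEuclideanLin D = toEuclideanLin (C * D) := by
      intro C D
      ext x i
      simp [toLpLin_apply, mulVec_mulVec]
    rw [Commute, SemiconjBy, h, h, hAB.eq]
  -- Restricting to actual eigenvalues makes the family of joint eigenspaces finite, as needed for a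
  -- subordinate orthonormal basis.
  let W : Eigenvalues b × Eigenvalues a → Submodule ℝ (EuclideanSpace ℝ (Fin n)) :=
    fun i => eigenspace a (i.2 : ℝ) ⊓ eigenspace b (i.1 : ℝ)
  have hW : OrthogonalFamily ℝ (fun i => W i) fun i => (W i).subtypeₗᵢ :=
    (ha.orthogonalFamily_eigenspace_inf_eigenspace hb).comp
      (f := fun i : Eigenvalues b × Eigenvalues a => ((i.1 : ℝ), (i.2 : ℝ)))
      (fun i j h => Prod.ext (Subtype.ext (congrArg Prod.fst h))
      (Subtype.ext (congrArg Prod.snd h)))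
  have hint : DirectSum.IsInternal W := by
    rw [hW.isInternal_iff, Submodule.orthogonal_eq_bot_iff, eq_top_iff,
      ← ha.iSup_iSup_eigenspace_inf_eigenspace_eq_top_of_commute hb hab]
    refine iSup_le fun r => iSup_le fun t => ?_
    by_cases hrt : eigenspace a r ⊓ eigenspace b t = ⊥
    · rw [hrt]; exact bot_le
    · have hr : HasEigenvalue a r := fun h => hrt (by
        rw [show eigenspace a r = ⊥ from h, bot_inf_eq])
      have ht : HasEigenvalue b t := fun h => hrt (by
        rw [show eigenspace b t = ⊥ from h, inf_bot_eq])
      exact le_iSup W (⟨t, ht⟩, ⟨r, hr⟩)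
  let e := hint.subordinateOrthonormalBasis (finrank_euclideanSpace_fin (𝕜 := ℝ) (n := n)) hW
  obtain ⟨ix, he⟩ : ∃ ix : Fin n → Eigenvalues b × Eigenvalues a, ∀ k, e k ∈ W (ix k) :=
    ⟨_, fun k => hint.subordinateOrthonormalBasis_subordinate
      (finrank_euclideanSpace_fin (𝕜 := ℝ) (n := n)) k hW⟩
  let P := (EuclideanSpace.basisFun (Fin n) ℝ).toBasis.toMatrix e
  refine ⟨P, (EuclideanSpace.basisFun (Fin n) ℝ).toMatrix_orthonormalBasis_mem_orthogonal e,
    fun k => (ix k).2, fun k => (ix k).1, ?_, ?_⟩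
  · ext i k
    have := congrArg (fun v : EuclideanSpace ℝ (Fin n) => v i) (mem_eigenspace_iff.mp (he k).1)
    rw [mul_diagonal, mul_comm]
    simpa [a, toLpLin_apply, mulVec, dotProduct, Matrix.mul_apply, P, Module.Basis.toMatrix_apply]
      using this
  · ext i k
    have := congrArg (fun v : EuclideanSpace ℝ (Fin n) => v i) (mem_eigenspace_iff.mp (he k).2)
    rw [mul_diagonal, mul_comm]
    simpa [b, toLpLin_apply, mulVec, dotProduct, Matrix.mul_apply, P, Module.Basis.toMatrix_apply]
      using this

end JointDiagonalization

/-- The complexification of a real matrix. -/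
abbrev complexify {m n : Type} (M : Matrix m n ℝ) : Matrix m n ℂ := M.map Complex.ofReal

theorem complexify_mul {l m n : Type} [Fintype m] (M : Matrix l m ℝ) (N : Matrix m n ℝ) :
    complexify (M * N) = complexify M * complexify N := by
  ext i j
  simp [mul_apply]

theorem exists_sq_eq_of_norm_eq_one {d : ℂ} (hd : ‖d‖ = 1) : ∃ s : ℂ, ‖s‖ = 1 ∧ s * s = d := by
  refine ⟨Complex.exp ((d.arg / 2 : ℝ) * Complex.I), Complex.norm_exp_ofReal_mul_I _, ?_⟩
  rw [← Complex.exp_add]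
  conv_rhs => rw [← Complex.norm_mul_exp_arg_mul_I d, hd]
  push_cast
  rw [one_mul]
  congr 1
  ring

/-- Every unitary matrix is a product of a real orthogonal, a diagonal, and a real orthogonal
matrix. -/
theorem exists_orthogonal_mul_diagonal_mul_orthogonal {n : ℕ} {V : Matrix (Fin n) (Fin n) ℂ}
    (hV : V ∈ unitaryGroup (Fin n) ℂ) :
    ∃ O ∈ orthogonalGroup (Fin n) ℝ, ∃ P ∈ orthogonalGroup (Fin n) ℝ, ∃ s : Fin n → ℂ,
      (∀ k, ‖s k‖ = 1) ∧ V = complexify O * diagonal s * complexify P := by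
  have hV1 : Vᴴ * V = 1 := mem_unitaryGroup_iff'.mp hV
  have hV2 : V * Vᴴ = 1 := mem_unitaryGroup_iff.mp hV
  -- If V = O s P with O, P real orthogonal, then VᵀV = Pᵀ s² P. Hence P comes from diagonalizing
  -- the symmetric unitary `M`, and s from square roots of its eigenvalues.
  set M := Vᵀ * V with hMdef
  have hMt : Mᵀ = M := by simp [hMdef]
  have hMs : ∀ i j, M i j = M j i := fun i j => by
    conv_lhs => rw [← hMt]
    rfl
  have hMM : Mᴴ * M = 1 := by
    rw [hMdef, conjTranspose_mul, Matrix.mul_assoc, ← Matrix.mul_assoc Vᵀᴴ]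
    have : Vᵀᴴ * Vᵀ = 1 := by
      rw [show Vᵀᴴ = Vᴴᵀ from rfl, ← transpose_mul, hV2, transpose_one]
    rw [this, Matrix.one_mul, hV1]
  obtain ⟨P, hP, α, β, hα, hβ⟩ := exists_orthogonal_joint_diagonalization
    (A := M.map Complex.re) (B := M.map Complex.im)
    (by ext i j; simp [hMs i j]) (by ext i j; simp [hMs i j]) (by
      ext i k
      -- For symmetric `M`, the imaginary part of `Mᴴ * M = 1` says that Re M and Im M commute.
      have := congrArg Complex.im (congrFun (congrFun hMM i) k)
      rw [mul_apply] at this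
      simp only [conjTranspose_apply, Complex.im_sum, Complex.star_def, Complex.mul_im,
        Complex.conj_re, Complex.conj_im, one_apply, apply_ite Complex.im, Complex.one_im,
        Complex.zero_im, ite_self, Finset.sum_add_distrib] at this
      simp only [mul_apply, map_apply]
      rw [← sub_eq_zero, ← this, sub_eq_add_neg, ← Finset.sum_neg_distrib]
      congr 1
      · exact Finset.sum_congr rfl fun j _ => by rw [hMs j i]
      · exact Finset.sum_congr rfl fun j _ => by rw [hMs j i]; ring)
  have hP1 : Pᵀ * P = 1 := (mem_orthogonalGroup_iff' (Fin n) ℝ).mp hP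
  have hP2 : P * Pᵀ = 1 := (mem_orthogonalGroup_iff (Fin n) ℝ).mp hP
  have hc1 : complexify Pᵀ * complexify P = 1 := by
    rw [← complexify_mul, hP1]; simp [complexify]
  have hc2 : complexify P * complexify Pᵀ = 1 := by
    rw [← complexify_mul, hP2]; simp [complexify]
  have hct : (complexify P)ᵀ = complexify Pᵀ := rfl
  have hch : (complexify P)ᴴ = complexify Pᵀ := by
    ext i j
    simp
  let d : Fin n → ℂ := fun k => α k + β k * Complex.I
  have hMP : M * complexify P = complexify P * diagonal d := by
    have hM : M = complexify (M.map Complex.re) + Complex.I • complexify (M.map Complex.im) := by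
      ext i j
      simp [mul_comm Complex.I]
    have hd : diagonal d = complexify (diagonal α) + Complex.I • complexify (diagonal β) := by
      ext i j
      by_cases hij : i = j
      · subst hij; simp [d, mul_comm Complex.I]
      · simp [hij]
    rw [hd, Matrix.mul_add, Matrix.mul_smul, ← complexify_mul, ← complexify_mul, ← hα, ← hβ,
      complexify_mul, complexify_mul, ← Matrix.smul_mul, ← Matrix.add_mul, ← hM]
  have hdM : diagonal d = complexify Pᵀ * M * complexify P := by
    rw [Matrix.mul_assoc, hMP, ← Matrix.mul_assoc, hc1, Matrix.one_mul]
  have hdn : ∀ k, ‖d k‖ = 1 := by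
    intro k
    have h : (diagonal d)ᴴ * diagonal d = 1 := by
      have : (diagonal d)ᴴ = complexify Pᵀ * Mᴴ * complexify P := by
        rw [hdM, conjTranspose_mul, conjTranspose_mul, hch, ← hch, conjTranspose_conjTranspose,
          Matrix.mul_assoc]
      rw [this, Matrix.mul_assoc _ _ (diagonal d), ← hMP, Matrix.mul_assoc, ← Matrix.mul_assoc Mᴴ,
        hMM, Matrix.one_mul, hc1]
    rw [diagonal_conjTranspose, diagonal_mul_diagonal, ← diagonal_one] at h
    have := congrFun (diagonal_injective h) k
    simp only [Pi.star_apply, Complex.star_def, Complex.conj_mul'] at this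
    have h2 : ‖d k‖ ^ 2 = 1 := by exact_mod_cast this
    nlinarith [norm_nonneg (d k)]
  choose s hs hsd using fun k => exists_sq_eq_of_norm_eq_one (hdn k)
  have hss : ∀ k, s k * star (s k) = 1 := by
    intro k
    rw [Complex.star_def, Complex.mul_conj', hs]
    norm_num
  set O := V * complexify P * diagonal (star s) with hO
  have hVO : V = O * diagonal s * complexify Pᵀ := by
    rw [hO, Matrix.mul_assoc (V * complexify P), diagonal_mul_diagonal]
    have : (fun i => star s i * s i) = fun _ => 1 := funext fun k => by
      rw [Pi.star_apply, mul_comm, hss]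
    rw [this, diagonal_one, Matrix.mul_one, Matrix.mul_assoc, hc2, Matrix.mul_one]
  have hOt : Oᵀ * O = 1 := by
    rw [hO, transpose_mul, transpose_mul, diagonal_transpose, hct]
    calc diagonal (star s) * (complexify Pᵀ * Vᵀ) * (V * complexify P * diagonal (star s))
        = diagonal (star s) * (complexify Pᵀ * M * complexify P) * diagonal (star s) := by
          rw [hMdef]; simp only [Matrix.mul_assoc]
      _ = 1 := by
          rw [← hdM, diagonal_mul_diagonal, diagonal_mul_diagonal, ← diagonal_one]
          congr 1
          funext k
          rw [← hsd, Pi.star_apply]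
          linear_combination (s k * star (s k) + 1) * hss k
  have hOh : O * Oᴴ = 1 := by
    rw [hO, conjTranspose_mul, conjTranspose_mul, diagonal_conjTranspose, hch, star_star]
    calc V * complexify P * diagonal (star s) * (diagonal s * (complexify Pᵀ * Vᴴ))
        = V * complexify P * (diagonal (star s) * diagonal s) * complexify Pᵀ * Vᴴ := by
          simp only [Matrix.mul_assoc]
      _ = 1 := by
          rw [diagonal_mul_diagonal]
          have : (fun i => star s i * s i) = fun _ => 1 := funext fun k => by
            rw [Pi.star_apply, mul_comm, hss]
          rw [this, diagonal_one, Matrix.mul_one, Matrix.mul_assoc V, hc2, Matrix.mul_one, hV2]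
  -- Both are inverses of `O`, so `O` equals its complex conjugate and is real.
  have hreal : Oᵀ = Oᴴ := by
    calc Oᵀ = Oᵀ * (O * Oᴴ) := by rw [hOh, Matrix.mul_one]
      _ = Oᴴ := by rw [← Matrix.mul_assoc, hOt, Matrix.one_mul]
  have hOre : O = complexify (O.map Complex.re) := by
    ext i j
    have := congrFun (congrFun hreal j) i
    simp only [transpose_apply, conjTranspose_apply, Complex.star_def] at this
    exact (Complex.conj_eq_iff_re.mp this.symm).symm
  refine ⟨O.map Complex.re, ?_, Pᵀ, ?_, s, hs, ?_⟩
  · rw [mem_orthogonalGroup_iff']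
    have h : complexify ((O.map Complex.re)ᵀ * O.map Complex.re) = complexify 1 := by
      rw [complexify_mul, ← hOre, show complexify (O.map Complex.re)ᵀ =
        (complexify (O.map Complex.re))ᵀ from rfl, ← hOre, hOt]
      simp [complexify]
    exact Matrix.map_injective Complex.ofReal_injective h
  · rw [mem_orthogonalGroup_iff]
    exact hP1
  · rw [← hOre]; exact hVO

/-! ### Isometries of the quaternions and local unitaries -/

section Quaternions

open scoped Quaternion

/-- Multiply w x̄ + x w̄ = 2⟨w, x⟩ by w on the right and use w̄ w = 1. -/
theorem reflection_eq_neg_mul_star_mul {w : ℍ[ℝ]} (hw : ‖w‖ = 1) (x : ℍ[ℝ]) :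
    (ℝ ∙ w)ᗮ.reflection x = -(w * star x * w) := by
  rw [Submodule.reflection_orthogonal_apply, Submodule.reflection_singleton_apply, hw]
  have h : w * star x + x * star w = ((2 * inner ℝ w x : ℝ) : ℍ[ℝ]) := by
    rw [Quaternion.inner_def]
    ext <;> simp <;> ring
  have h1 : star w * w = 1 := by
    rw [Quaternion.star_mul_self, Quaternion.normSq_eq_norm_mul_self, hw]
    simp
  have h2 : w * star x * w + x = ((2 * inner ℝ w x : ℝ) : ℍ[ℝ]) * w := by
    rw [← h, add_mul, mul_assoc x, h1, mul_one]
  rw [Quaternion.coe_mul_eq_smul] at h2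
  rw [eq_sub_of_add_eq h2]
  simp [mul_smul, two_smul]

/-- A linear isometry of the quaternions is of the form `x ↦ p * x * q` or `x ↦ p * star x * q`. -/
theorem exists_eq_mul_mul_or_eq_mul_star_mul (f : ℍ[ℝ] ≃ₗᵢ[ℝ] ℍ[ℝ]) :
    ∃ p q : ℍ[ℝ], ‖p‖ = 1 ∧ ‖q‖ = 1 ∧
      ((∀ x, f x = p * x * q) ∨ ∀ x, f x = p * star x * q) := by
  obtain ⟨l, -, rfl⟩ := f.reflections_generate_dim
  induction l with
  | nil => exact ⟨1, 1, by simp, by simp, Or.inl fun x => by simp⟩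
  | cons v l ih =>
    obtain ⟨p, q, hp, hq, h⟩ := ih
    rw [List.map_cons, List.prod_cons]
    -- The list of reflecting vectors may contain 0, whose reflection is the identity.
    by_cases hv : v = 0
    · refine ⟨p, q, hp, hq, ?_⟩
      have : (ℝ ∙ v)ᗮ.reflection = 1 := by
        ext1 x
        rw [hv, Submodule.reflection_orthogonal_apply, Submodule.reflection_singleton_apply]
        simp
      rwa [this, one_mul]
    · set w := (‖v‖⁻¹ : ℝ) • v with hwdef
      have hw : ‖w‖ = 1 := by
        rw [hwdef, norm_smul, norm_inv, norm_norm, inv_mul_cancel₀ (norm_ne_zero_iff.mpr hv)]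
      have hspan : (ℝ ∙ v) = ℝ ∙ w :=
        (Submodule.span_singleton_smul_eq
          (IsUnit.mk0 _ (inv_ne_zero (norm_ne_zero_iff.mpr hv))) v).symm
      simp only [hspan]
      -- Composing with the reflection exchanges the two forms: −w (p x q)‾ w = −(w q̄) x̄ (p̄ w).
      refine ⟨-(w * star q), star p * w, by simp [hw, hq], by simp [hw, hp], ?_⟩
      rcases h with h | h
      · right
        intro x
        rw [LinearIsometryEquiv.coe_mul, Function.comp_apply, h, reflection_eq_neg_mul_star_mul hw]
        simp only [star_mul, neg_mul, mul_assoc]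
      · left
        intro x
        rw [LinearIsometryEquiv.coe_mul, Function.comp_apply, h, reflection_eq_neg_mul_star_mul hw]
        simp only [star_mul, star_star, neg_mul, mul_assoc]

/-- The complexification of the representation of quaternions by complex matrices. -/
def quatMatrix (x : Fin 4 → ℂ) : Matrix (Fin 2) (Fin 2) ℂ :=
  !![x 0 + Complex.I * x 1, x 2 + Complex.I * x 3; -x 2 + Complex.I * x 3, x 0 - Complex.I * x 1]

/-- The coordinates of a quaternion as complex numbers. -/
def quatCoords (x : ℍ[ℝ]) : Fin 4 → ℂ := ![x.re, x.imI, x.imJ, x.imK]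

theorem quatMatrix_add_smul (x y : Fin 4 → ℂ) (c : ℂ) :
    quatMatrix (x + c • y) = quatMatrix x + c • quatMatrix y := by
  ext i j
  fin_cases i <;> fin_cases j <;> simp [quatMatrix] <;> ring

theorem quatMatrix_mul (x y : ℍ[ℝ]) :
    quatMatrix (quatCoords (x * y)) = quatMatrix (quatCoords x) * quatMatrix (quatCoords y) := by
  ext i j
  fin_cases i <;> fin_cases j <;>
    simp [quatMatrix, quatCoords, mul_apply, Fin.sum_univ_two] <;>
    ring_nf <;> simp only [Complex.I_sq] <;> ring

theorem quatMatrix_star (x : ℍ[ℝ]) :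
    quatMatrix (quatCoords (star x)) = (quatMatrix (quatCoords x))ᴴ := by
  ext i j
  fin_cases i <;> fin_cases j <;> simp [quatMatrix, quatCoords]

theorem quatMatrix_mem_unitaryGroup {p : ℍ[ℝ]} (hp : ‖p‖ = 1) :
    quatMatrix (quatCoords p) ∈ unitaryGroup (Fin 2) ℂ := by
  rw [mem_unitaryGroup_iff, star_eq_conjTranspose, ← quatMatrix_star, ← quatMatrix_mul,
    Quaternion.self_mul_star, Quaternion.normSq_eq_norm_mul_self, hp]
  ext i j
  fin_cases i <;> fin_cases j <;> simp [quatMatrix, quatCoords]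

/-- The signs of the action of quaternion conjugation, or of the identity, on coordinates. -/
def conjSign (b : Bool) : Fin 4 → ℂ := ![1, bif b then -1 else 1, bif b then -1 else 1,
  bif b then -1 else 1]

theorem conjSign_mul_self (b : Bool) (k : Fin 4) : conjSign b k * conjSign b k = 1 := by
  cases b <;> fin_cases k <;> simp [conjSign]

theorem norm_conjSign (b : Bool) (k : Fin 4) : ‖conjSign b k‖ = 1 := by
  cases b <;> fin_cases k <;> simp [conjSign]

/-- Real orthogonal matrices are local, up to quaternion conjugation. -/
theorem exists_quatMatrix_mulVec {O : Matrix (Fin 4) (Fin 4) ℝ}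
    (hO : O ∈ orthogonalGroup (Fin 4) ℝ) :
    ∃ A C : unitaryGroup (Fin 2) ℂ, ∃ b : Bool, ∀ x : Fin 4 → ℂ,
      quatMatrix (O.map Complex.ofReal *ᵥ x) =
        (A : Matrix _ _ ℂ) * quatMatrix (conjSign b * x) * (C : Matrix _ _ ℂ) := by
  let t := Quaternion.linearIsometryEquivTuple
  let g := Unitary.linearIsometryEquiv (𝕜 := ℝ) (H := EuclideanSpace ℝ (Fin 4))
    ⟨toEuclideanCLM (𝕜 := ℝ) O, Unitary.map_mem (toEuclideanCLM (n := Fin 4) (𝕜 := ℝ)) hO⟩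
  let f : ℍ[ℝ] ≃ₗᵢ[ℝ] ℍ[ℝ] := (t.trans g).trans t.symm
  have hf : ∀ u, quatCoords (f u) = O.map Complex.ofReal *ᵥ quatCoords u := by
    intro u
    have h : ∀ k, t (f u) k = (O *ᵥ (t u).ofLp) k := by
      intro k
      simp [f, g]
      rfl
    have h0 := h 0
    have h1 := h 1
    have h2 := h 2
    have h3 := h 3
    simp [t, mulVec, dotProduct, Fin.sum_univ_four] at h0 h1 h2 h3
    funext k
    fin_cases k <;> simp [quatCoords, mulVec, dotProduct, Fin.sum_univ_four, h0, h1, h2, h3]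
  -- The isometry theorem covers real coordinates only; complex linearity extends the formula to all
  -- amplitude vectors.
  have hdec : ∀ x : Fin 4 → ℂ, ∃ u v : ℍ[ℝ], x = quatCoords u + Complex.I • quatCoords v := by
    intro x
    refine ⟨⟨(x 0).re, (x 1).re, (x 2).re, (x 3).re⟩, ⟨(x 0).im, (x 1).im, (x 2).im, (x 3).im⟩, ?_⟩
    funext k
    fin_cases k <;> simp [quatCoords, mul_comm Complex.I]
  have hsign : ∀ u, quatCoords (star u) = conjSign true * quatCoords u := by
    intro u
    funext k
    fin_cases k <;> simp [quatCoords, conjSign]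
  obtain ⟨p, q, hp, hq, h⟩ := exists_eq_mul_mul_or_eq_mul_star_mul f
  have key : ∃ b, ∀ u, quatMatrix (quatCoords (f u)) = quatMatrix (quatCoords p) *
      quatMatrix (conjSign b * quatCoords u) * quatMatrix (quatCoords q) := by
    rcases h with h | h
    · refine ⟨false, fun u => ?_⟩
      have : conjSign false = 1 := by
        funext k
        fin_cases k <;> rfl
      rw [h, quatMatrix_mul, quatMatrix_mul, this, one_mul]
    · refine ⟨true, fun u => ?_⟩
      rw [h, quatMatrix_mul, quatMatrix_mul, hsign]
  obtain ⟨b, key⟩ := key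
  refine ⟨⟨_, quatMatrix_mem_unitaryGroup hp⟩, ⟨_, quatMatrix_mem_unitaryGroup hq⟩, b, fun x => ?_⟩
  obtain ⟨u, v, rfl⟩ := hdec x
  rw [mulVec_add, mulVec_smul, ← hf, ← hf, quatMatrix_add_smul, key, key, mul_add, mul_smul_comm,
    quatMatrix_add_smul]
  simp only [Matrix.mul_add, Matrix.add_mul, Matrix.mul_smul, Matrix.smul_mul]

end Quaternions

/-! ### Diagonal matrices in the magic basis as three phase gates -/

theorem conj_invSqrtTwo : (starRingEnd ℂ) invSqrtTwo = invSqrtTwo := star_invSqrtTwo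

/-- The Hadamard gate. -/
def hadamardGate : unitaryGroup (Fin 2) ℂ :=
  ⟨invSqrtTwo • !![1, 1; 1, -1], by
    rw [mem_unitaryGroup_iff]
    ext i j
    fin_cases i <;> fin_cases j <;>
      simp [mul_apply, Fin.sum_univ_two, conj_invSqrtTwo, invSqrtTwo_mul_self] <;> norm_num⟩

/-- The unitary involution that exchanges the Pauli matrices `Y` and `Z`. -/
def swapYZ : unitaryGroup (Fin 2) ℂ :=
  ⟨invSqrtTwo • !![1, -Complex.I; Complex.I, -1], by
    have h : invSqrtTwo * Complex.I * (invSqrtTwo * Complex.I) = -(1 / 2) := by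
      rw [mul_mul_mul_comm, invSqrtTwo_mul_self, Complex.I_mul_I]; ring
    rw [mem_unitaryGroup_iff]
    ext i j
    fin_cases i <;> fin_cases j <;>
      simp [mul_apply, Fin.sum_univ_two, conj_invSqrtTwo, invSqrtTwo_mul_self, h] <;>
      ring1⟩

/-- The diagonal of the two-qubit gate `exp (i t Z ⊗ Z)`, where `c = exp (i t)`. -/
def phaseGate (c : ℂ) : Matrix (Fin 2) (Fin 2) ℂ := !![c, star c; star c, c]

theorem star_mul_phaseGate {c : ℂ} (hc : ‖c‖ = 1) (a b : Fin 2) :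
    star (phaseGate c a b) * phaseGate c a b = 1 := by
  have h : (starRingEnd ℂ) c * c = 1 := by rw [Complex.conj_mul', hc]; norm_num
  fin_cases a <;> fin_cases b <;> simp [phaseGate, h, mul_comm c]

/-- The phase gate is diagonal in the magic basis and splits the coordinates as {0, 1} and {2, 3}.
Conjugated by `swapYZ` or by `hadamardGate` it splits them as {0, 2}, {1, 3} or as {0, 3}, {1, 2}.
-/
theorem phaseGate_hadamard_quatMatrix (c : ℂ) (x : Fin 4 → ℂ) :
    phaseGate c ⊙ quatMatrix x = quatMatrix ![c * x 0, c * x 1, star c * x 2, star c * x 3] := by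
  ext i j
  fin_cases i <;> fin_cases j <;> simp [phaseGate, quatMatrix] <;> ring

theorem hadamardGate_conj_quatMatrix (x : Fin 4 → ℂ) :
    (hadamardGate : Matrix _ _ ℂ) * quatMatrix x * (hadamardGate : Matrix _ _ ℂ) =
      quatMatrix ![x 0, x 3, -x 2, x 1] := by
  ext i j
  have h := invSqrtTwo_mul_self
  fin_cases i <;> fin_cases j <;>
    simp [hadamardGate, quatMatrix, mul_apply, Fin.sum_univ_two]
  · linear_combination (2 * x 0 + 2 * Complex.I * x 3) * h
  · linear_combination (-2 * x 2 + 2 * Complex.I * x 1) * h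
  · linear_combination (2 * x 2 + 2 * Complex.I * x 1) * h
  · linear_combination (2 * x 0 - 2 * Complex.I * x 3) * h

theorem swapYZ_conj_quatMatrix (x : Fin 4 → ℂ) :
    (swapYZ : Matrix _ _ ℂ) * quatMatrix x * (swapYZ : Matrix _ _ ℂ) =
      quatMatrix ![x 0, x 2, x 1, -x 3] := by
  ext i j
  have h := invSqrtTwo_mul_self
  fin_cases i <;> fin_cases j <;>
    simp [swapYZ, quatMatrix, mul_apply, Fin.sum_univ_two] <;> ring_nf <;>
    simp only [Complex.I_sq, Complex.I_pow_three, pow_two invSqrtTwo, h] <;> ring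

/-- In terms of arguments this is a linear system whose matrix of signs is a 4 × 4 Hadamard matrix;
its inverse is a quarter of its transpose, hence the divisions by 4. -/
theorem exists_phases {δ : Fin 4 → ℂ} (hδ : ∀ k, ‖δ k‖ = 1) :
    ∃ f a b c : ℂ, ‖f‖ = 1 ∧ ‖a‖ = 1 ∧ ‖b‖ = 1 ∧ ‖c‖ = 1 ∧ δ = ![f * (a * b * c),
      f * (star a * star b * c), f * (star a * b * star c), f * (a * star b * star c)] := by
  let θ : Fin 4 → ℝ := fun k => (δ k).arg
  have hθ : ∀ k, δ k = Complex.exp (θ k * Complex.I) := fun k => by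
    conv_lhs => rw [← Complex.norm_mul_exp_arg_mul_I (δ k), hδ]
    simp [θ]
  refine ⟨Complex.exp (((θ 0 + θ 1 + θ 2 + θ 3) / 4 : ℝ) * Complex.I),
    Complex.exp (((θ 0 + θ 3 - θ 1 - θ 2) / 4 : ℝ) * Complex.I),
    Complex.exp (((θ 0 + θ 2 - θ 1 - θ 3) / 4 : ℝ) * Complex.I),
    Complex.exp (((θ 0 + θ 1 - θ 2 - θ 3) / 4 : ℝ) * Complex.I),
    Complex.norm_exp_ofReal_mul_I _, Complex.norm_exp_ofReal_mul_I _,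
    Complex.norm_exp_ofReal_mul_I _, Complex.norm_exp_ofReal_mul_I _, ?_⟩
  funext k
  rw [hθ]
  fin_cases k <;>
    simp only [Complex.star_def, ← Complex.exp_conj, ← Complex.exp_add, map_mul, Complex.conj_I,
      Complex.conj_ofReal, Fin.zero_eta, Fin.mk_one, Fin.reduceFinMk, cons_val] <;>
    congr 1 <;> push_cast <;> ring

/-- Diagonal unitaries in the magic basis are products of three phase gates and local gates. -/
theorem exists_quatMatrix_mul {δ : Fin 4 → ℂ} (hδ : ∀ k, ‖δ k‖ = 1) :
    ∃ f a b c : ℂ, ‖f‖ = 1 ∧ ‖a‖ = 1 ∧ ‖b‖ = 1 ∧ ‖c‖ = 1 ∧ ∀ y, quatMatrix (δ * y) =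
      f • ((hadamardGate : Matrix _ _ ℂ) * (phaseGate a ⊙ ((hadamardGate : Matrix _ _ ℂ) *
        ((swapYZ : Matrix _ _ ℂ) * (phaseGate b ⊙ ((swapYZ : Matrix _ _ ℂ) *
          (phaseGate c ⊙ quatMatrix y) * (swapYZ : Matrix _ _ ℂ))) * (swapYZ : Matrix _ _ ℂ)) *
            (hadamardGate : Matrix _ _ ℂ))) * (hadamardGate : Matrix _ _ ℂ)) := by
  obtain ⟨f, a, b, c, hf, ha, hb, hc, rfl⟩ := exists_phases hδ
  refine ⟨f, a, b, c, hf, ha, hb, hc, fun y => ?_⟩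
  simp only [phaseGate_hadamard_quatMatrix, swapYZ_conj_quatMatrix, hadamardGate_conj_quatMatrix]
  rw [← zero_add (f • _), show (0 : Matrix (Fin 2) (Fin 2) ℂ) = quatMatrix 0 by
    ext i j; fin_cases i <;> fin_cases j <;> simp [quatMatrix], ← quatMatrix_add_smul, zero_add]
  congr 1
  funext k
  fin_cases k <;> simp <;> ring

/-! ### The magic basis and the Cartan decomposition -/

/-- The magic basis. -/
def magicBasis : Matrix (Fin 2 → Fin 2) (Fin 4) ℂ :=
  of fun b k => invSqrtTwo * quatMatrix (Pi.single k 1) (b 0) (b 1)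

theorem magicBasis_conjTranspose_mul : magicBasisᴴ * magicBasis = 1 := by
  have hsum : ∀ F : (Fin 2 → Fin 2) → ℂ, ∑ b, F b = F ![0, 0] + F ![0, 1] + F ![1, 0] + F ![1, 1]
      := by
    intro F
    rw [← (finTwoArrowEquiv (Fin 2)).symm.sum_comp, Fintype.sum_prod_type]
    simp [Fin.sum_univ_two, add_assoc]
  ext i j
  rw [mul_apply, hsum]
  fin_cases i <;> fin_cases j <;>
    simp [magicBasis, quatMatrix, conj_invSqrtTwo, invSqrtTwo_mul_self, Pi.single_apply] <;>
    ring_nf <;> simp [pow_two invSqrtTwo, invSqrtTwo_mul_self] 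

theorem magicBasis_mul_conjTranspose : magicBasis * magicBasisᴴ = 1 :=
  (mul_eq_one_comm_of_card_eq _ _ _ (by simp)).mp magicBasis_conjTranspose_mul

theorem ampMatrix_magicBasis_mulVec (x : Fin 4 → ℂ) :
    ampMatrix (magicBasis *ᵥ x) = invSqrtTwo • quatMatrix x := by
  ext i j
  fin_cases i <;> fin_cases j <;>
    simp [ampMatrix, magicBasis, mulVec, dotProduct, Fin.sum_univ_four, quatMatrix] <;> ring

/-- The Cartan decomposition of two-qubit unitaries: up to local unitaries, every two-qubit unitary
is diagonal in the magic basis. -/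
theorem exists_cartan_decomposition (U : unitaryGroup (Fin 2 → Fin 2) ℂ) :
    ∃ A C A' C' : unitaryGroup (Fin 2) ℂ, ∃ δ : Fin 4 → ℂ, (∀ k, ‖δ k‖ = 1) ∧ ∀ ψ, ∃ y,
      quatMatrix y = (A' : Matrix _ _ ℂ) * ampMatrix ψ * (C' : Matrix _ _ ℂ) ∧
      ampMatrix ((U : Matrix _ _ ℂ) *ᵥ ψ) =
        (A : Matrix _ _ ℂ) * quatMatrix (δ * y) * (C : Matrix _ _ ℂ) := by
  let u : Matrix (Fin 2 → Fin 2) (Fin 2 → Fin 2) ℂ := U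
  have hV : magicBasisᴴ * u * magicBasis ∈ unitaryGroup (Fin 4) ℂ := by
    rw [mem_unitaryGroup_iff', star_eq_conjTranspose]
    calc (magicBasisᴴ * u * magicBasis)ᴴ *
          (magicBasisᴴ * u * magicBasis)
        = magicBasisᴴ * (uᴴ * ((magicBasis * magicBasisᴴ) *
          u)) * magicBasis := by
          simp only [conjTranspose_mul, conjTranspose_conjTranspose, Matrix.mul_assoc]
      _ = 1 := by
          rw [magicBasis_mul_conjTranspose, Matrix.one_mul, ← star_eq_conjTranspose u,
            show star u * u = 1 from mem_unitaryGroup_iff'.mp U.2, Matrix.mul_one,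
            magicBasis_conjTranspose_mul]
  obtain ⟨O, hO, P, hP, s, hs, hOP⟩ := exists_orthogonal_mul_diagonal_mul_orthogonal hV
  obtain ⟨A, C, b, hAC⟩ := exists_quatMatrix_mulVec hO
  -- The local form is taken for Pᵀ = P⁻¹, which expresses the input through `P *ᵥ x`; inverting its
  -- local factors gives those applied before the diagonal.
  have hPt : Pᵀ ∈ orthogonalGroup (Fin 4) ℝ := by
    rw [mem_orthogonalGroup_iff']
    exact (mem_orthogonalGroup_iff (Fin 4) ℝ).mp hP
  obtain ⟨A', C', b', hAC'⟩ := exists_quatMatrix_mulVec hPt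
  -- Any quaternion conjugations in O and Pᵀ are diagonal sign matrices and are absorbed into the
  -- diagonal factor.
  refine ⟨A, C, A'⁻¹, C'⁻¹, conjSign b * s * conjSign b', ?_, fun ψ => ?_⟩
  · intro k
    simp [norm_conjSign, hs]
  have hψ : ψ = magicBasis *ᵥ (magicBasisᴴ *ᵥ ψ) := by
    rw [mulVec_mulVec, magicBasis_mul_conjTranspose, one_mulVec]
  set x := magicBasisᴴ *ᵥ ψ
  have hUψ : (U : Matrix _ _ ℂ) *ᵥ ψ =
      magicBasis *ᵥ ((complexify O * diagonal s * complexify P) *ᵥ x) := by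
    rw [← hOP, mulVec_mulVec, Matrix.mul_assoc magicBasisᴴ, ← Matrix.mul_assoc,
        magicBasis_mul_conjTranspose,
      Matrix.one_mul, ← mulVec_mulVec, ← hψ]
  have hx : x = complexify Pᵀ *ᵥ (complexify P *ᵥ x) := by
    rw [mulVec_mulVec, ← complexify_mul, (mem_orthogonalGroup_iff' (Fin 4) ℝ).mp hP]
    simp [complexify]
  have hσ : ∀ (b : Bool) (v : Fin 4 → ℂ), conjSign b * (conjSign b * v) = v := by
    intro b v
    funext k
    simp [← mul_assoc, conjSign_mul_self]
  have hsmul : ∀ (c : ℂ) (v : Fin 4 → ℂ), quatMatrix (c • v) = c • quatMatrix v := by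
    intro c v
    have := quatMatrix_add_smul 0 v c
    rwa [zero_add, show quatMatrix 0 = 0 by
      ext i j; fin_cases i <;> fin_cases j <;> simp [quatMatrix], zero_add] at this
  refine ⟨invSqrtTwo • (conjSign b' * (complexify P *ᵥ x)), ?_, ?_⟩
  · rw [hψ, ampMatrix_magicBasis_mulVec, hsmul, Matrix.mul_smul, Matrix.smul_mul]
    congr 1
    conv_rhs => rw [hx, hAC']
    have h1 : ((A'⁻¹ : unitaryGroup (Fin 2) ℂ) : Matrix (Fin 2) (Fin 2) ℂ) *
        (A' : Matrix (Fin 2) (Fin 2) ℂ) = 1 := by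
      rw [← UnitaryGroup.mul_val, inv_mul_cancel, UnitaryGroup.one_val]
    have h2 : (C' : Matrix (Fin 2) (Fin 2) ℂ) *
        ((C'⁻¹ : unitaryGroup (Fin 2) ℂ) : Matrix (Fin 2) (Fin 2) ℂ) = 1 := by
      rw [← UnitaryGroup.mul_val, mul_inv_cancel, UnitaryGroup.one_val]
    rw [Matrix.mul_assoc, Matrix.mul_assoc, h2, Matrix.mul_one, ← Matrix.mul_assoc, h1,
      Matrix.one_mul]
  · have hd : ∀ v, diagonal s *ᵥ v = s * v := fun v => funext fun k => mulVec_diagonal s v k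
    rw [hUψ, ampMatrix_magicBasis_mulVec, ← mulVec_mulVec, ← mulVec_mulVec, hAC, hd, mul_smul_comm,
      hsmul, Matrix.mul_smul, Matrix.smul_mul, mul_assoc (conjSign b * s), hσ,
      mul_assoc (conjSign b)]

end NetworkCoding

end

open Matrix NetworkCoding in
theorem mainTheorem2 (U : Matrix.unitaryGroup (Fin 2 → Fin 2) ℂ) :
    NetworkCoding.grailNetwork.DeterministicallyImplementable U := by
  obtain ⟨A, C, A', C', δ, hδ, hU⟩ := exists_cartan_decomposition U
  obtain ⟨f, a, b, c, hf, ha, hb, hc, hG⟩ := exists_quatMatrix_mul hδ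
  -- The global phase `f` is absorbed into the last local gate on the first qubit.
  have hfA : f • (A : Matrix (Fin 2) (Fin 2) ℂ) ∈ unitaryGroup (Fin 2) ℂ := by
    rw [mem_unitaryGroup_iff, star_smul, smul_mul_smul_comm, mem_unitaryGroup_iff.mp A.2,
      Complex.star_def, Complex.mul_conj', hf]
    simp
  -- Adjacent local gates are merged. The phase gates appear in the order of application, `c` first.
  refine implementable_of_circuit U ![A', swapYZ, hadamardGate * swapYZ, ⟨_, hfA⟩ * hadamardGate]
    ![C', swapYZ, swapYZ * hadamardGate, hadamardGate * C]
    ![phaseGate c, phaseGate b, phaseGate a] ?_ fun ψ => ?_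
  · intro j
    fin_cases j
    exacts [star_mul_phaseGate hc, star_mul_phaseGate hb, star_mul_phaseGate ha]
  · obtain ⟨y, hy, hUy⟩ := hU ψ
    rw [hUy, hG, hy]
    simp only [cons_val, UnitaryGroup.mul_val, Matrix.mul_smul, Matrix.smul_mul, Matrix.mul_assoc]
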